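/- For $n\ge 1$ consider the Cauchy problem $$u_{tt}-\Delta u+\Delta^2u_t=0\quad (t>0,\ x\in\mathbf R^n),\qquad u(0,\cdot)=u_0,\quad u_t(0,\cdot)=u_1 .$$ For $u_0\in H^1(\mathbf R^n)$, $u_1\in L^2(\mathbf R^n)$, its solution means the solution $u\in C([0,\infty);H^1(\mathbf R^n))\cap C^1([0,\infty);L^2(\mathbf R^n))$; that is, $u(0)=u_0$, $u_t(0)=u_1$, and for every Schwartz function $\varphi$ and $t\ge0$ (one-sided derivative at $t=0$) $$\frac{d}{dt}\int_{\mathbf R^n} u_t\varphi\,dx=\int_{\mathbf R^n} u\,\Delta\varphi\,dx-\int_{\mathbf R^n} u_t\,\Delta^2\varphi\,dx .$$ Notation: $\hat f(\xi)=(2\pi)^{-n/2}\int_{\mathbf R^n} e^{-ix\cdot\xi}f(x)\,dx$ (extended to $L^2$); $\|\cdot\|_2$ is the norm of $L^2(\mathbf R^n)$; for $p\ge0$, $\|f\|_{H^p}=\big(\int_{\mathbf R^n}(1+|\xi|^{2p})|\hat f(\xi)|^2\,d\xi\big)^{1/2}$ and $H^p(\mathbf R^n)$ is the set of $f\in L^2(\mathbf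 R^n)$ for which it is finite; for $\gamma\ge0$, $\|f\|_{1,\gamma}=\int_{\mathbf R^n}(1+|x|)^\gamma|f(x)|\,dx$ and $L^{1,\gamma}(\mathbf R^n)$ is the set of $f\in L^1(\mathbf R^n)$ for which it is finite; for $l\ge 0$, $$I^{l,0}(u_0,u_1)=\|u_0\|_{H^{l+1}}+\|u_1\|_{H^l}+\|u_0\|_{1,0}+\|u_1\|_{1,1}.$$ (i) Let $n\ge6$ and $0\le l\le \frac n4-\frac32$. There are constants $C>0$ and $T$, depending only on $n$ and $l$, such that for all $u_0\in H^{l+1}(\mathbf R^n)\cap L^1(\mathbf R^n)$ and $u_1\in H^l(\mathbf R^n)\cap L^{1,1}(\mathbf R^n)$ the solution $u$ satisfies $$\|u(t,\cdot)\|_2\le C\,I^{l,0}(u_0,u_1)\,t^{-\frac{l+1}{2}},\qquad t\ge T.$$ (ii) Let $n\ge1$, and let $l\ge0$ if $1\le n\le6$, and $l\ge\frac n4-\frac32$ if $n\ge7$. There are constants $C>0$ and $T$, depending only on $n$ and $l$, such that for all $u_0\in H^{l+1}(\mathbf R^n)\cap L^1(\mathbf R^n)$ and $u_1\in H^l(\mathbf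 R^n)\cap L^{1,1}(\mathbf R^n)$ the solution $u$ satisfies, for $t\ge T$, $$\|u(t,\cdot)\|_2\le\begin{cases} C\,I^{l,0}(u_0,u_1)\sqrt t, & n=1,\\ C\,I^{l,0}(u_0,u_1)\sqrt{\log t}, & n=2,\\ C\,I^{l,0}(u_0,u_1)\,t^{-\frac n8+\frac14}, & n\ge3.\end{cases}$$ -/

import Mathlib

open Filter Topology MeasureTheory Set
open scoped SchwartzMap Laplacian FourierTransform ENNReal

namespace StructuralDamping

/-- The space `ℝⁿ` with its Euclidean norm. -/
abbrev Space (n : ℕ) : Type := EuclideanSpace ℝ (Fin n)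

/-- The space `L²(ℝⁿ)` of (classes of) complex-valued functions. Real-valued data and solutions
are the special case of functions with values in `ℝ ⊆ ℂ`. -/
abbrev L2 (n : ℕ) : Type := Lp ℂ 2 (volume : Measure (Space n))

/-- The Fourier transform on `L²(ℝⁿ)` in the unitary normalization
`f̂(ξ) = (2π)^(-n/2) ∫ e^(-i x·ξ) f(x) dx`. Mathlib's transform `𝓕 f` uses `e^(-2πi x·η)`, hence
the dilation `η = ξ / (2π)`. -/
noncomputable def fourierHat {n : ℕ} (f : L2 n) (ξ : Space n) : ℂ :=
  (((2 * Real.pi) ^ (-(n : ℝ) / 2) : ℝ) : ℂ) * (𝓕 f : L2 n) ((2 * Real.pi)⁻¹ • ξ)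

/-- `f` belongs to the Sobolev space `H^p(ℝⁿ)`, `p ≥ 0`: it is an `L²` function with
`∫ (1 + |ξ|^(2p)) |f̂(ξ)|² dξ < ∞`. -/
def MemHSobolev {n : ℕ} (p : ℝ) (f : L2 n) : Prop :=
  Integrable (fun ξ : Space n => (1 + ‖ξ‖ ^ (2 * p)) * ‖fourierHat f ξ‖ ^ 2)

/-- The norm `‖f‖_{H^p} = (∫ (1 + |ξ|^(2p)) |f̂(ξ)|² dξ)^(1/2)`. -/
noncomputable def hSobolevNorm {n : ℕ} (p : ℝ) (f : L2 n) : ℝ :=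
  Real.sqrt (∫ ξ : Space n, (1 + ‖ξ‖ ^ (2 * p)) * ‖fourierHat f ξ‖ ^ 2)

/-- `f` belongs to the weighted space `L^{1,γ}(ℝⁿ)`, `γ ≥ 0`. -/
def MemWeightedL1 {n : ℕ} (γ : ℝ) (f : L2 n) : Prop :=
  Integrable (fun x : Space n => f x) ∧
    Integrable (fun x : Space n => (1 + ‖x‖) ^ γ * ‖f x‖)

/-- The norm `‖f‖_{1,γ} = ∫ (1 + |x|)^γ |f(x)| dx`. -/
noncomputable def weightedL1Norm {n : ℕ} (γ : ℝ) (f : L2 n) : ℝ :=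
  ∫ x : Space n, (1 + ‖x‖) ^ γ * ‖f x‖

/-- The quantity `I^{l,γ}(u₀,u₁) = ‖u₀‖_{H^{l+1}} + ‖u₁‖_{H^l} + ‖u₀‖_{1,γ} + ‖u₁‖_{1,γ+1}`. -/
noncomputable def dataNorm {n : ℕ} (l γ : ℝ) (u₀ u₁ : L2 n) : ℝ :=
  hSobolevNorm (l + 1) u₀ + hSobolevNorm l u₁ + weightedL1Norm γ u₀ + weightedL1Norm (γ + 1) u₁

/-- `u` (of which only the values `u t` with `t ≥ 0` matter) is the solution of
`u_tt - Δ u + Δ² u_t = 0`, `u(0) = u₀`, `u_t(0) = u₁`, in the class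
`C([0,∞); H¹(ℝⁿ)) ∩ C¹([0,∞); L²(ℝⁿ))`. The function `v` is `u_t`, the time derivative in `L²`
(one-sided at `t = 0`), and the equation `v_t = Δ u - Δ² v` is understood in the sense of tempered
distributions in `x`, tested against an arbitrary Schwartz function `φ`. -/
def IsSolution {n : ℕ} (u₀ u₁ : L2 n) (u : ℝ → L2 n) : Prop :=
  ∃ v : ℝ → L2 n,
    -- `u ∈ C([0,∞); H¹)`
    (∀ t, 0 ≤ t → MemHSobolev 1 (u t)) ∧
    (∀ t, 0 ≤ t → Tendsto (fun s => hSobolevNorm 1 (u s - u t)) (𝓝[Ici 0] t) (𝓝 0)) ∧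
    -- `u ∈ C¹([0,∞); L²)` with `u_t = v`
    (∀ t, 0 ≤ t → HasDerivWithinAt u (v t) (Ici 0) t) ∧
    ContinuousOn v (Ici 0) ∧
    -- initial conditions
    u 0 = u₀ ∧ v 0 = u₁ ∧
    -- the equation
    ∀ t, 0 ≤ t → ∀ φ : 𝓢(Space n, ℂ),
      HasDerivWithinAt (fun s => (v s : 𝓢'(Space n, ℂ)) φ)
        ((Δ (u t : 𝓢'(Space n, ℂ)) - Δ (Δ (v t : 𝓢'(Space n, ℂ)))) φ) (Ici 0) t

/-- The rate `√t` for `n = 1`, `√(log t)` for `n = 2`, `t^(-n/8 + 1/4)` for `n ≥ 3`. -/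
noncomputable def diffusionRate (n : ℕ) (t : ℝ) : ℝ :=
  if n = 1 then Real.sqrt t
  else if n = 2 then Real.sqrt (Real.log t)
  else t ^ (-(n : ℝ) / 8 + 1 / 4)

end StructuralDamping

/-! On the Fourier side each frequency `r = |ξ|` carries the oscillator `U'' + r⁴ U' + r² U = 0`,
with roots `-r⁴/2 ± √(r⁸/4 - r²)`. For `r ≤ 1` the roots are complex, and the kernel of `u₁` is
`e^{-r⁴t/2} sin(νt)/ν` with `ν ≥ r/2` (`norm_le_low`). The transforms of `L¹` data are bounded, so
this region contributes to `‖u‖²` at most a multiple of `∫ e^{-r⁴t/2} min(t, 2/r)² dξ`, that is of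
`t`, `log t` or `t^{-n/4+1/2}` for `n = 1`, `n = 2`, `n ≥ 3`: the square of the diffusion rate. For
large `r` the slow root is close to `-1/r²`, so decay is not uniform in `r` (`norm_le_high`) and has
to be bought with derivatives: `e^{-t/(2r²)} ≤ C t^{-(l+1)} r^{2(l+1)}`. The kernel of `u₁` gains a
factor `1/r`, which is why `u₁` needs one derivative less than `u₀`. Together these give `‖u‖² ≤ C
I² (rate² + t^{-(l+1)})` (`exists_norm_sq_le`). The two claims record which summand dominates; for
`n ≥ 3` the exponents cross at `l = n/4 - 3/2`.

The solution is only a weak one, so its Fourier representation has to be derived. Testing and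
integrating in time gives `V = V₀ - r⁴(U - U₀) - r² ∫U` almost everywhere
(`exists_fourier_identity`). On a ball of frequencies all symbols are bounded, so `V - λ₋U` solves a
linear ODE in `L²` with bounded multiplier `λ₊` and is multiplied by `e^{tλ₊}`; likewise with the
roots exchanged (`modes_evolution`). Off a null set of frequencies the two modes determine `U`. -/

namespace StructuralDamping

/-! ### Characteristic roots and pointwise bounds for a single frequency -/

/-- A quarter of the discriminant of the characteristic polynomial `λ² + r⁴ λ + r²`. -/
noncomputable def disc (r : ℝ) : ℝ := r ^ 8 / 4 - r ^ 2

/-- A square root of `disc r`. -/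
noncomputable def halfGap (r : ℝ) : ℂ :=
  (Real.sqrt (disc r) : ℂ) + (Real.sqrt (-disc r) : ℂ) * Complex.I

/-- The characteristic roots `λ` of `λ² + r⁴ λ + r² = 0`; `s` is the sign `± 1`. -/
noncomputable def charRoot (s : ℝ) (r : ℝ) : ℂ := -((r : ℂ) ^ 4 / 2) + s * halfGap r

/-- One of the two real square roots always vanishes, so the cross term drops out and both signs of
`disc r` are covered by one formula. -/
lemma halfGap_sq (r : ℝ) : halfGap r ^ 2 = (disc r : ℂ) := by
  unfold halfGap
  have key : Real.sqrt (disc r) * Real.sqrt (-disc r) = 0 := by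
    rcases le_total (disc r) 0 with h | h
    · rw [Real.sqrt_eq_zero_of_nonpos h, zero_mul]
    · rw [Real.sqrt_eq_zero_of_nonpos (neg_nonpos.2 h), mul_zero]
  have h2 : Real.sqrt (disc r) ^ 2 - Real.sqrt (-disc r) ^ 2 = disc r := by
    rcases le_total (disc r) 0 with h | h
    · rw [Real.sqrt_eq_zero_of_nonpos h, Real.sq_sqrt (by linarith)]; ring
    · rw [Real.sqrt_eq_zero_of_nonpos (neg_nonpos.2 h), Real.sq_sqrt h]; ring
  have key' : (Real.sqrt (disc r) : ℂ) * Real.sqrt (-disc r) = 0 := by exact_mod_cast key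
  have h2' : (Real.sqrt (disc r) : ℂ) ^ 2 - (Real.sqrt (-disc r) : ℂ) ^ 2 = disc r := by
    exact_mod_cast h2
  linear_combination (2 * Complex.I) * key' + h2' +
    (Real.sqrt (-disc r) : ℂ) ^ 2 * Complex.I_sq

lemma charRoot_add (s r : ℝ) : charRoot s r + charRoot (-s) r = -(r : ℂ) ^ 4 := by
  unfold charRoot; push_cast; ring

lemma charRoot_mul {s : ℝ} (hs : s ^ 2 = 1) (r : ℝ) :
    charRoot s r * charRoot (-s) r = (r : ℂ) ^ 2 := by
  have h := halfGap_sq r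
  have hs' : (s : ℂ) ^ 2 = 1 := by exact_mod_cast hs
  unfold charRoot
  simp only [disc] at h
  push_cast at h ⊢
  linear_combination -(halfGap r) ^ 2 * hs' - h

lemma continuous_charRoot (s : ℝ) : Continuous (charRoot s) := by
  unfold charRoot halfGap disc
  fun_prop

/-- Solving the two modes for `U`. -/
lemma two_halfGap_mul_eq {r t : ℝ} {U V U₀ V₀ : ℂ}
    (hp : V - charRoot (-1) r * U = Complex.exp (t * charRoot 1 r) * (V₀ - charRoot (-1) r * U₀))
    (hn : V - charRoot 1 r * U = Complex.exp (t * charRoot (-1) r) * (V₀ - charRoot 1 r * U₀)) :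
    2 * halfGap r * U = Complex.exp (((-(r ^ 4 / 2) * t : ℝ) : ℂ)) *
      ((Complex.exp (halfGap r * t) - Complex.exp (-(halfGap r * t))) * (V₀ + (r : ℂ) ^ 4 / 2 * U₀)
        + halfGap r * (Complex.exp (halfGap r * t) + Complex.exp (-(halfGap r * t))) * U₀) := by
  have e1 : Complex.exp (t * charRoot 1 r) =
      Complex.exp (((-(r ^ 4 / 2) * t : ℝ) : ℂ)) * Complex.exp (halfGap r * t) := by
    rw [← Complex.exp_add]; congr 1; unfold charRoot; push_cast; ring
  have e2 : Complex.exp (t * charRoot (-1) r) =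
      Complex.exp (((-(r ^ 4 / 2) * t : ℝ) : ℂ)) * Complex.exp (-(halfGap r * t)) := by
    rw [← Complex.exp_add]; congr 1; unfold charRoot; push_cast; ring
  rw [e1] at hp
  rw [e2] at hn
  unfold charRoot at hp hn
  push_cast at hp hn ⊢
  linear_combination hp - hn

/-- The bound obtained from the real kernels `S = sinh (ω t) / ω` and `cosh (ω t)`. -/
lemma norm_le_of_kernels {r t S K : ℝ} {U U₀ V₀ : ℂ}
    (h : U = Complex.exp (((-(r ^ 4 / 2) * t : ℝ) : ℂ)) *
      ((S : ℂ) * (V₀ + (r : ℂ) ^ 4 / 2 * U₀) + (K : ℂ) * U₀)) :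
    ‖U‖ ≤ Real.exp (-(r ^ 4 / 2) * t) * (|S| * ‖V₀‖ + (|K| + r ^ 4 / 2 * |S|) * ‖U₀‖) := by
  rw [h, norm_mul, Complex.norm_exp, Complex.ofReal_re]
  gcongr
  calc _ ≤ ‖(S : ℂ) * (V₀ + (r : ℂ) ^ 4 / 2 * U₀)‖ + ‖(K : ℂ) * U₀‖ := norm_add_le _ _
    _ ≤ |S| * (‖V₀‖ + r ^ 4 / 2 * ‖U₀‖) + |K| * ‖U₀‖ := by
      rw [norm_mul, norm_mul, Complex.norm_real, Complex.norm_real, Real.norm_eq_abs,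
        Real.norm_eq_abs]
      gcongr
      refine (norm_add_le _ _).trans ?_
      gcongr
      rw [norm_mul]
      gcongr
      rw [norm_div, norm_pow, Complex.norm_real, Real.norm_eq_abs]
      simp [pow_abs, abs_of_nonneg (by positivity : (0 : ℝ) ≤ r ^ 4)]
    _ = _ := by ring

/-- The kernels are `sin(νt)/ν` and `cos(νt)`. Keeping the bound `t` beside `1/ν` makes the estimate
survive `ν → 0`, near the double root. -/
lemma norm_le_of_disc_neg {r t : ℝ} (hd : disc r < 0) (ht : 0 ≤ t) {U V U₀ V₀ : ℂ}
    (hp : V - charRoot (-1) r * U = Complex.exp (t * charRoot 1 r) * (V₀ - charRoot (-1) r * U₀))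
    (hn : V - charRoot 1 r * U = Complex.exp (t * charRoot (-1) r) * (V₀ - charRoot 1 r * U₀)) :
    ‖U‖ ≤ Real.exp (-(r ^ 4 / 2) * t) *
      (min t (1 / Real.sqrt (-disc r)) * ‖V₀‖ + (1 + r ^ 4 / 2 * t) * ‖U₀‖) := by
  set ν := Real.sqrt (-disc r) with hν
  have hνpos : 0 < ν := Real.sqrt_pos.2 (by linarith)
  have hω : halfGap r = ν * Complex.I := by
    unfold halfGap; rw [Real.sqrt_eq_zero_of_nonpos hd.le]; simp [hν]
  have key := two_halfGap_mul_eq hp hn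
  have e1 : Complex.exp (halfGap r * t) - Complex.exp (-(halfGap r * t)) =
      2 * Complex.I * ((Real.sin (ν * t) : ℝ) : ℂ) := by
    rw [Complex.ofReal_sin, Complex.sin, hω]
    push_cast
    rw [show (ν : ℂ) * Complex.I * t = ν * t * Complex.I by ring,
      show -(ν * t * Complex.I : ℂ) = -(ν * t) * Complex.I by ring]
    linear_combination (Complex.exp (ν * t * Complex.I) - Complex.exp (-(ν * t) * Complex.I))
      * Complex.I_sq
  have e2 : Complex.exp (halfGap r * t) + Complex.exp (-(halfGap r * t)) =
      2 * ((Real.cos (ν * t) : ℝ) : ℂ) := by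
    rw [Complex.ofReal_cos, Complex.cos, hω]
    push_cast
    rw [show (ν : ℂ) * Complex.I * t = ν * t * Complex.I by ring,
      show -(ν * t * Complex.I : ℂ) = -(ν * t) * Complex.I by ring]
    ring
  have hU : U = Complex.exp (((-(r ^ 4 / 2) * t : ℝ) : ℂ)) *
      (((Real.sin (ν * t) / ν : ℝ) : ℂ) * (V₀ + (r : ℂ) ^ 4 / 2 * U₀)
        + ((Real.cos (ν * t) : ℝ) : ℂ) * U₀) := by
    rw [e1, e2, hω] at key
    have hν0 : (ν : ℂ) ≠ 0 := by exact_mod_cast hνpos.ne'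
    have h2 : (2 * (ν * Complex.I) : ℂ) ≠ 0 := by simp [hν0]
    apply mul_left_cancel₀ h2
    rw [key, Complex.ofReal_div]
    field_simp
  have hS1 : |Real.sin (ν * t) / ν| ≤ t := by
    rw [abs_div, abs_of_pos hνpos, div_le_iff₀ hνpos]
    calc |Real.sin (ν * t)| ≤ |ν * t| := Real.abs_sin_le_abs
      _ = t * ν := by rw [abs_of_nonneg (by positivity)]; ring
  have hS2 : |Real.sin (ν * t) / ν| ≤ 1 / ν := by
    rw [abs_div, abs_of_pos hνpos]
    gcongr
    exact Real.abs_sin_le_one _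
  refine (norm_le_of_kernels hU).trans ?_
  gcongr
  · exact le_min hS1 hS2
  · exact Real.abs_cos_le_one _

/-- The hyperbolic kernels grow like `e^{ωt}`; against the damping `e^{-r⁴t/2}` only the slow root
is left, and it is at most `-1/r²`. -/
lemma norm_le_of_disc_pos {r t : ℝ} (hr : 0 < r) (hd : 0 < disc r) (ht : 0 ≤ t) {U V U₀ V₀ : ℂ}
    (hp : V - charRoot (-1) r * U = Complex.exp (t * charRoot 1 r) * (V₀ - charRoot (-1) r * U₀))
    (hn : V - charRoot 1 r * U = Complex.exp (t * charRoot (-1) r) * (V₀ - charRoot 1 r * U₀)) :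
    ‖U‖ ≤ Real.exp (-t / r ^ 2) * (min t (1 / Real.sqrt (disc r)) * ‖V₀‖ +
        (1 + r ^ 4 / 2 * min t (1 / Real.sqrt (disc r))) * ‖U₀‖) := by
  set ω := Real.sqrt (disc r) with hω'
  have hωpos : 0 < ω := Real.sqrt_pos.2 hd
  have hω : halfGap r = ω := by
    unfold halfGap; rw [Real.sqrt_eq_zero_of_nonpos (neg_nonpos.2 hd.le)]; simp [hω']
  have key := two_halfGap_mul_eq hp hn
  have e1 : Complex.exp (halfGap r * t) - Complex.exp (-(halfGap r * t)) =
      2 * ((Real.sinh (ω * t) : ℝ) : ℂ) := by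
    rw [Complex.ofReal_sinh, Complex.sinh, hω]
    push_cast
    ring
  have e2 : Complex.exp (halfGap r * t) + Complex.exp (-(halfGap r * t)) =
      2 * ((Real.cosh (ω * t) : ℝ) : ℂ) := by
    rw [Complex.ofReal_cosh, Complex.cosh, hω]
    push_cast
    ring
  have hU : U = Complex.exp (((-(r ^ 4 / 2) * t : ℝ) : ℂ)) *
      (((Real.sinh (ω * t) / ω : ℝ) : ℂ) * (V₀ + (r : ℂ) ^ 4 / 2 * U₀)
        + ((Real.cosh (ω * t) : ℝ) : ℂ) * U₀) := by
    rw [e1, e2, hω] at key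
    have hν0 : (ω : ℂ) ≠ 0 := by exact_mod_cast hωpos.ne'
    have h2 : (2 * (ω) : ℂ) ≠ 0 := by simp [hν0]
    apply mul_left_cancel₀ h2
    rw [key, Complex.ofReal_div]
    field_simp
  have hx : 0 ≤ ω * t := by positivity
  have hneg : Real.exp (-(ω * t)) ≤ Real.exp (ω * t) := Real.exp_le_exp.2 (by linarith)
  have hK : |Real.cosh (ω * t)| ≤ Real.exp (ω * t) := by
    rw [abs_of_pos (Real.cosh_pos _), Real.cosh_eq]; linarith
  have hsinh : 0 ≤ Real.sinh (ω * t) := Real.sinh_nonneg_iff.2 hx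
  have hS1 : |Real.sinh (ω * t) / ω| ≤ Real.exp (ω * t) * t := by
    rw [abs_div, abs_of_pos hωpos, abs_of_nonneg hsinh, div_le_iff₀ hωpos]
    -- With `x = ωt`: `sinh x = eˣ(1 - e^{-2x})/2 ≤ x eˣ`.
    have h1 : 1 + -(2 * (ω * t)) ≤ Real.exp (-(2 * (ω * t))) := by
      linarith [Real.add_one_le_exp (-(2 * (ω * t)))]
    have h2 : Real.exp (-(ω * t)) = Real.exp (ω * t) * Real.exp (-(2 * (ω * t))) := by
      rw [← Real.exp_add]; congr 1; ring
    rw [Real.sinh_eq, h2]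
    nlinarith [Real.exp_pos (ω * t)]
  have hS2 : |Real.sinh (ω * t) / ω| ≤ Real.exp (ω * t) * (1 / ω) := by
    rw [abs_div, abs_of_pos hωpos, abs_of_nonneg hsinh, mul_one_div]
    gcongr
    rw [Real.sinh_eq]
    linarith [Real.exp_pos (ω * t), Real.exp_pos (-(ω * t))]
  have hrate : Real.exp (-(r ^ 4 / 2) * t) * Real.exp (ω * t) ≤ Real.exp (-t / r ^ 2) := by
    rw [← Real.exp_add, Real.exp_le_exp]
    -- The square of the right-hand side exceeds `disc r` by exactly `1/r⁴`.
    have hωle : ω ≤ r ^ 4 / 2 - 1 / r ^ 2 := by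
      have h8 : 4 < r ^ 6 := by
        unfold disc at hd
        have : r ^ 2 * (r ^ 6 - 4) > 0 := by nlinarith
        have := pos_of_mul_pos_right this (by positivity)
        linarith
      rw [hω']
      apply Real.sqrt_le_iff.2
      constructor
      · rw [sub_nonneg, div_le_iff₀ (by positivity)]; nlinarith
      · have : (r ^ 4 / 2 - 1 / r ^ 2) ^ 2 = disc r + (1 / r ^ 2) ^ 2 := by
          unfold disc; field_simp; ring
        rw [this]
        nlinarith [sq_nonneg (1 / r ^ 2)]
    calc -(r ^ 4 / 2) * t + ω * t ≤ -(r ^ 4 / 2) * t + (r ^ 4 / 2 - 1 / r ^ 2) * t := by gcongr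
      _ = -t / r ^ 2 := by ring
  have hm : |Real.sinh (ω * t) / ω| ≤ Real.exp (ω * t) * min t (1 / ω) := by
    rw [mul_min_of_nonneg _ _ (Real.exp_pos _).le]
    exact le_min hS1 hS2
  have hmin : 0 ≤ min t (1 / ω) := by positivity
  calc ‖U‖ ≤ _ := norm_le_of_kernels hU
    _ ≤ Real.exp (-(r ^ 4 / 2) * t) * (Real.exp (ω * t) * min t (1 / ω) * ‖V₀‖ +
        (Real.exp (ω * t) + r ^ 4 / 2 * (Real.exp (ω * t) * min t (1 / ω))) * ‖U₀‖) := by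
      gcongr
    _ = (Real.exp (-(r ^ 4 / 2) * t) * Real.exp (ω * t)) * (min t (1 / ω) * ‖V₀‖ +
        (1 + r ^ 4 / 2 * min t (1 / ω)) * ‖U₀‖) := by ring
    _ ≤ _ := by gcongr

/-- Low frequencies: damped oscillations. -/
lemma norm_le_low {r t : ℝ} (hr : 0 < r) (hr1 : r ≤ 1) (ht : 0 ≤ t) {U V U₀ V₀ : ℂ}
    (hp : V - charRoot (-1) r * U = Complex.exp (t * charRoot 1 r) * (V₀ - charRoot (-1) r * U₀))
    (hn : V - charRoot 1 r * U = Complex.exp (t * charRoot (-1) r) * (V₀ - charRoot 1 r * U₀)) :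
    ‖U‖ ≤ 2 * Real.exp (-(r ^ 4 / 4) * t) * ‖U₀‖ +
      Real.exp (-(r ^ 4 / 2) * t) * min t (2 / r) * ‖V₀‖ := by
  have h6 : r ^ 6 ≤ 1 := pow_le_one₀ hr.le hr1
  have hd4 : r ^ 2 / 4 ≤ -disc r := by
    unfold disc
    nlinarith [mul_le_mul_of_nonneg_left h6 (sq_nonneg r), sq_nonneg r]
  have hd : disc r < 0 := by nlinarith [sq_pos_of_pos hr]
  have hν : r / 2 ≤ Real.sqrt (-disc r) := by
    apply Real.le_sqrt_of_sq_le; nlinarith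
  refine (norm_le_of_disc_neg hd ht hp hn).trans ?_
  have h1 : 1 / Real.sqrt (-disc r) ≤ 2 / r := by
    rw [show 2 / r = 1 / (r / 2) by field_simp]
    gcongr
  -- With `z = r⁴t/4` this is `1 + 2z ≤ 2eᶻ`: half of the damping pays for the factor growing in
  -- `t`.
  have h2 : Real.exp (-(r ^ 4 / 2) * t) * (1 + r ^ 4 / 2 * t) ≤
      2 * Real.exp (-(r ^ 4 / 4) * t) := by
    have : Real.exp (-(r ^ 4 / 2) * t) * Real.exp (r ^ 4 / 4 * t) = Real.exp (-(r ^ 4 / 4) * t) := by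
      rw [← Real.exp_add]; congr 1; ring
    rw [← this]
    have := Real.add_one_le_exp (r ^ 4 / 4 * t)
    have h0 := Real.exp_pos (-(r ^ 4 / 2) * t)
    nlinarith
  calc _ = Real.exp (-(r ^ 4 / 2) * t) * (1 + r ^ 4 / 2 * t) * ‖U₀‖ +
      Real.exp (-(r ^ 4 / 2) * t) * min t (1 / Real.sqrt (-disc r)) * ‖V₀‖ := by ring
    _ ≤ _ := by gcongr

/-- High frequencies: the slow mode decays like `exp (-t / r²)`. -/
lemma norm_le_high {r t : ℝ} (hr : 1 ≤ r) (hd : disc r ≠ 0) (ht : 0 ≤ t) {U V U₀ V₀ : ℂ}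
    (hp : V - charRoot (-1) r * U = Complex.exp (t * charRoot 1 r) * (V₀ - charRoot (-1) r * U₀))
    (hn : V - charRoot 1 r * U = Complex.exp (t * charRoot (-1) r) * (V₀ - charRoot 1 r * U₀)) :
    ‖U‖ ≤ 20 * Real.exp (-t / (4 * r ^ 2)) * (‖U₀‖ + r⁻¹ * ‖V₀‖) := by
  have hr0 : 0 < r := by linarith
  set y := t / (4 * r ^ 2) with hy
  have hy0 : 0 ≤ y := by positivity
  have hty : t = 4 * r ^ 2 * y := by rw [hy]; field_simp
  have hexp : ∀ A B E : ℝ, E * A ≤ 20 * Real.exp (-y) * r⁻¹ → E * B ≤ 20 * Real.exp (-y) →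
      ‖U‖ ≤ E * (A * ‖V₀‖ + B * ‖U₀‖) →
      ‖U‖ ≤ 20 * Real.exp (-t / (4 * r ^ 2)) * (‖U₀‖ + r⁻¹ * ‖V₀‖) := by
    intro A B E h1 h2 h
    rw [neg_div, ← hy]
    calc _ ≤ _ := h
      _ = E * A * ‖V₀‖ + E * B * ‖U₀‖ := by ring
      _ ≤ (20 * Real.exp (-y) * r⁻¹) * ‖V₀‖ + (20 * Real.exp (-y)) * ‖U₀‖ := by gcongr
      _ = _ := by ring
  -- Surplus exponential decay absorbs one factor `y`, that is, one factor `t`.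
  have hye : ∀ k : ℝ, 0 ≤ k → y * Real.exp (-(k + 2) * y) ≤ Real.exp (-y) := by
    intro k hk
    calc y * Real.exp (-(k + 2) * y) ≤ Real.exp y * Real.exp (-(k + 2) * y) := by
          gcongr; linarith [Real.add_one_le_exp y]
      _ ≤ Real.exp (-y) := by
          rw [← Real.exp_add, Real.exp_le_exp]; nlinarith [mul_nonneg hk hy0]
  rcases lt_or_gt_of_ne hd with hd | hd
  · have h6 : r ^ 6 < 4 := by
      unfold disc at hd
      by_contra! h
      nlinarith [mul_le_mul_of_nonneg_left h (sq_nonneg r)]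
    have hr2 : r ^ 2 < 2 := by
      by_contra! h
      have : (2 : ℝ) ^ 3 ≤ (r ^ 2) ^ 3 := by gcongr
      nlinarith
    have hr3 : r < 3 / 2 := by nlinarith
    have hrinv : 2 / 3 ≤ r⁻¹ := by
      rw [← inv_inv (2 / 3 : ℝ)]; gcongr; linarith
    have h46 : (1 : ℝ) ≤ r ^ 6 := one_le_pow₀ hr
    have hE : Real.exp (-(r ^ 4 / 2) * t) ≤ Real.exp (-(0 + 2) * y) := by
      rw [Real.exp_le_exp, hty]
      nlinarith [mul_le_mul_of_nonneg_right h46 hy0]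
    have hk := hye 0 le_rfl
    have hk1 : Real.exp (-(0 + 2) * y) ≤ Real.exp (-y) := by
      rw [Real.exp_le_exp]; linarith
    have h2y : 0 ≤ Real.exp (-y) := (Real.exp_pos _).le
    have hmix : Real.exp (-(r ^ 4 / 2) * t) * (1 + r ^ 4 / 2 * t) ≤ 20 * Real.exp (-y) := by
      have hz : Real.exp (-(r ^ 4 / 2) * t) * (1 + r ^ 4 / 2 * t) ≤
          2 * Real.exp (-(r ^ 4 / 4) * t) := by
        have : Real.exp (-(r ^ 4 / 2) * t) * Real.exp (r ^ 4 / 4 * t) =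
            Real.exp (-(r ^ 4 / 4) * t) := by
          rw [← Real.exp_add]; congr 1; ring
        rw [← this]
        have := Real.add_one_le_exp (r ^ 4 / 4 * t)
        have h0 := Real.exp_pos (-(r ^ 4 / 2) * t)
        nlinarith
      have : Real.exp (-(r ^ 4 / 4) * t) ≤ Real.exp (-y) := by
        rw [Real.exp_le_exp, hty]
        nlinarith [mul_le_mul_of_nonneg_right h46 hy0]
      linarith
    refine hexp _ _ _ ?_ hmix (norm_le_of_disc_neg hd ht hp hn)
    calc Real.exp (-(r ^ 4 / 2) * t) * min t (1 / Real.sqrt (-disc r))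
        ≤ Real.exp (-(0 + 2) * y) * (4 * 2 * y) := by
          gcongr
          refine (min_le_left _ _).trans ?_
          rw [hty]; gcongr
      _ ≤ 8 * Real.exp (-y) := by linarith
      _ ≤ 20 * Real.exp (-y) * r⁻¹ := by nlinarith
  · have hm0 : 0 ≤ min t (1 / Real.sqrt (disc r)) := by positivity
    have hE : Real.exp (-t / r ^ 2) = Real.exp (-(2 + 2) * y) := by
      congr 1; rw [hy]; field_simp; ring
    have hk := hye 2 (by norm_num)
    have hk1 : Real.exp (-(2 + 2) * y) ≤ Real.exp (-y) := by
      rw [Real.exp_le_exp]; linarith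
    have h2y : 0 < Real.exp (-y) := Real.exp_pos _
    have hb := norm_le_of_disc_pos hr0 hd ht hp hn
    rw [hE] at hb
    -- For `r² ≤ 2` the gap `ω` may be arbitrarily small, so the bound `t` of the kernel is used;
    -- beyond that `ω` is of size `r⁴` and `1/ω` is better.
    rcases le_total (r ^ 2) 2 with h2 | h2
    · have hr3 : r ≤ 3 / 2 := by nlinarith
      have hrinv : 2 / 3 ≤ r⁻¹ := by
        rw [← inv_inv (2 / 3 : ℝ)]; gcongr; linarith
      have hmt : min t (1 / Real.sqrt (disc r)) ≤ 4 * r ^ 2 * y :=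
        (min_le_left _ _).trans hty.le
      refine hexp _ _ _ ?_ ?_ hb
      · calc _ ≤ Real.exp (-(2 + 2) * y) * (4 * 2 * y) := by gcongr; exact hmt.trans (by gcongr)
          _ ≤ 8 * Real.exp (-y) := by linarith
          _ ≤ 20 * Real.exp (-y) * r⁻¹ := by nlinarith
      · have hr4 : r ^ 4 / 2 ≤ 2 := by nlinarith
        calc _ ≤ Real.exp (-(2 + 2) * y) * (1 + 2 * (4 * 2 * y)) := by
              gcongr; exact hmt.trans (by gcongr)
          _ ≤ 20 * Real.exp (-y) := by linarith
    · have hω : r ^ 4 / 4 ≤ Real.sqrt (disc r) := by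
        apply Real.le_sqrt_of_sq_le
        have : (2 : ℝ) ^ 3 ≤ (r ^ 2) ^ 3 := by gcongr
        unfold disc
        nlinarith [mul_le_mul_of_nonneg_left this (sq_nonneg r)]
      have hm : min t (1 / Real.sqrt (disc r)) ≤ 4 / r ^ 4 := by
        refine (min_le_right _ _).trans ?_
        rw [show 4 / r ^ 4 = 1 / (r ^ 4 / 4) by field_simp]
        gcongr
      refine hexp _ _ _ ?_ ?_ hb
      · have : 4 / r ^ 4 ≤ 20 * r⁻¹ := by
          rw [div_le_iff₀ (by positivity), mul_assoc]
          have h3 : r⁻¹ * r ^ 4 = r ^ 3 := by field_simp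
          rw [h3]
          have : 1 ≤ r ^ 3 := one_le_pow₀ hr
          linarith
        calc _ ≤ Real.exp (-y) * (20 * r⁻¹) := by gcongr; exact hm.trans this
          _ = _ := by ring
      · have : 1 + r ^ 4 / 2 * min t (1 / Real.sqrt (disc r)) ≤ 20 := by
          calc _ ≤ 1 + r ^ 4 / 2 * (4 / r ^ 4) := by gcongr
            _ = 3 := by field_simp; norm_num
            _ ≤ 20 := by norm_num
        calc _ ≤ Real.exp (-y) * 20 := by gcongr
          _ = _ := by ring

/-! ### Linear evolution in `L²` with a bounded multiplier -/

section Multiplier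

variable {α : Type*} [MeasurableSpace α] {μ : Measure α}

lemma memLp_top_of_norm_le {a : α → ℂ} (ha : Measurable a) {K : ℝ} (hK : ∀ x, ‖a x‖ ≤ K) :
    MemLp a ∞ μ :=
  memLp_top_of_bound ha.aestronglyMeasurable K (ae_of_all _ hK)

lemma norm_toLp_top_le {a : α → ℂ} (ha : MemLp a ∞ μ) {K : ℝ} (hK0 : 0 ≤ K)
    (hK : ∀ x, ‖a x‖ ≤ K) : ‖ha.toLp a‖ ≤ K := by
  rw [Lp.norm_toLp, eLpNorm_exponent_top]
  refine ENNReal.toReal_le_of_le_ofReal hK0 ?_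
  refine eLpNormEssSup_le_of_ae_bound (ae_of_all _ hK)

lemma norm_exp_mul_le {a : ℂ} {K : ℝ} (hK : ‖a‖ ≤ K) (s : ℝ) :
    ‖Complex.exp (s * a)‖ ≤ Real.exp (|s| * K) := by
  refine (Complex.norm_exp_le_exp_norm _).trans ?_
  rw [Real.exp_le_exp, norm_mul, Complex.norm_real, Real.norm_eq_abs]
  gcongr

lemma memLp_top_exp {a : α → ℂ} (ha : Measurable a) {K : ℝ} (hK : ∀ x, ‖a x‖ ≤ K) (s : ℝ) :
    MemLp (fun x => Complex.exp (s * a x)) ∞ μ :=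
  memLp_top_of_norm_le (by fun_prop) (fun x => norm_exp_mul_le (hK x) s)

lemma memLp_top_mul_exp {a : α → ℂ} (ha : Measurable a) {K : ℝ} (hK : ∀ x, ‖a x‖ ≤ K) (s : ℝ) :
    MemLp (fun x => a x * Complex.exp (s * a x)) ∞ μ := by
  refine memLp_top_of_norm_le (K := K * Real.exp (|s| * K)) (by fun_prop) (fun x => ?_)
  rw [norm_mul]
  gcongr
  · exact (norm_nonneg _).trans (hK x)
  · exact hK x
  · exact norm_exp_mul_le (hK x) s

/-- The multipliers `exp (s a)` are differentiable in `s` in the norm of `L^∞`. -/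
lemma hasDerivAt_toLp_exp {a : α → ℂ} (ha : Measurable a) {K : ℝ} (hK : ∀ x, ‖a x‖ ≤ K) (s : ℝ) :
    HasDerivAt (fun s : ℝ => (memLp_top_exp (μ := μ) ha hK s).toLp _)
      ((memLp_top_mul_exp (μ := μ) ha hK s).toLp _) s := by
  rw [hasDerivAt_iff_isLittleO_nhds_zero]
  -- The remainder is uniformly quadratic because `|eᶻ - 1 - z| ≤ |z|²` for `|z| ≤ 1`, hence the
  -- restriction to `|h| |K| ≤ 1`.
  have hbig : (fun h : ℝ => (memLp_top_exp (μ := μ) ha hK (s + h)).toLp _ -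
      (memLp_top_exp (μ := μ) ha hK s).toLp _ - h • (memLp_top_mul_exp (μ := μ) ha hK s).toLp _)
      =O[𝓝 0] fun h : ℝ => h ^ 2 := by
    rw [Asymptotics.isBigO_iff]
    refine ⟨Real.exp (|s| * |K|) * |K| ^ 2, ?_⟩
    have hev : ∀ᶠ h : ℝ in 𝓝 0, |h| * |K| ≤ 1 := by
      have : Tendsto (fun h : ℝ => |h| * |K|) (𝓝 0) (𝓝 (|0| * |K|)) :=
        (continuous_abs.mul continuous_const).tendsto 0
      simp only [abs_zero, zero_mul] at this
      exact (this.eventually_lt_const one_pos).mono fun h hh => hh.le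
    filter_upwards [hev] with h hh
    rw [← MemLp.toLp_const_smul, ← MemLp.toLp_sub, ← MemLp.toLp_sub]
    refine norm_toLp_top_le _ (by positivity) (fun x => ?_)
    have hKx : ‖a x‖ ≤ |K| := (hK x).trans (le_abs_self K)
    have hn : ‖(h : ℂ) * a x‖ ≤ |h| * |K| := by
      rw [norm_mul, Complex.norm_real, Real.norm_eq_abs]; gcongr
    have e : Complex.exp (((s + h : ℝ) : ℂ) * a x) - Complex.exp (s * a x) -
        h • (a x * Complex.exp (s * a x)) =
        Complex.exp (s * a x) * (Complex.exp (h * a x) - 1 - h * a x) := by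
      have : Complex.exp (((s + h : ℝ) : ℂ) * a x) =
          Complex.exp (s * a x) * Complex.exp (h * a x) := by
        rw [← Complex.exp_add]; congr 1; push_cast; ring
      rw [this, Complex.real_smul]; ring
    simp only [Pi.sub_apply, Pi.smul_apply]
    rw [e, norm_mul]
    calc _ ≤ Real.exp (|s| * |K|) * (‖(h : ℂ) * a x‖ ^ 2) := by
          gcongr
          · exact norm_exp_mul_le hKx s
          · exact Complex.norm_exp_sub_one_sub_id_le (hn.trans hh)
      _ ≤ Real.exp (|s| * |K|) * ((|h| * |K|) ^ 2) := by gcongr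
      _ = _ := by rw [Real.norm_eq_abs, abs_pow]; ring
  refine hbig.trans_isLittleO ?_
  simpa using Asymptotics.isLittleO_pow_id (𝕜 := ℝ) (n := 2) one_lt_two

/-- The action of `L^∞` on `L²` by multiplication, as a bounded bilinear map. -/
noncomputable def mulL (μ : Measure α) : Lp ℂ ∞ μ →L[ℝ] Lp ℂ 2 μ →L[ℝ] Lp ℂ 2 μ :=
  (ContinuousLinearMap.mul ℝ ℂ).holderL μ ∞ 2 2

lemma coeFn_mulL {a : α → ℂ} (ha : MemLp a ∞ μ) (f : Lp ℂ 2 μ) :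
    mulL μ (ha.toLp a) f =ᵐ[μ] fun x => a x * f x := by
  have h := (ContinuousLinearMap.mul ℝ ℂ).coeFn_holder (r := 2) (ha.toLp a) f
  filter_upwards [h, ha.coeFn_toLp] with x hx hx2
  rw [← hx2]
  exact hx

/-- An `L²`-valued function satisfying `Z' = a Z` with a bounded multiplier `a` is given by
`Z(t) = exp (t a) Z(0)`. -/
lemma ae_eq_exp_mul_of_hasDerivWithinAt {a : α → ℂ} (ha : Measurable a) {K : ℝ}
    (hK : ∀ x, ‖a x‖ ≤ K) {Z : ℝ → Lp ℂ 2 μ}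
    (hZ : ∀ t, 0 ≤ t →
      HasDerivWithinAt Z (mulL μ ((memLp_top_of_norm_le ha hK).toLp a) (Z t)) (Ici 0) t)
    {t : ℝ} (ht : 0 ≤ t) :
    ∀ᵐ x ∂μ, Z t x = Complex.exp (t * a x) * Z 0 x := by
  have hna : ∀ x, ‖-a x‖ ≤ K := fun x => by rw [norm_neg]; exact hK x
  -- Integrating factor `e^{-sa}`: the product `E Z` has zero derivative on the half-line, so it is
  -- constant.
  set E : ℝ → Lp ℂ ∞ μ := fun s => (memLp_top_exp (μ := μ) ha.neg hna s).toLp _ with hE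
  have hder : ∀ s ∈ Ici (0 : ℝ), HasDerivWithinAt (fun s => mulL μ (E s) (Z s)) 0 (Ici 0) s := by
    intro s hs
    have h1 : HasDerivWithinAt E _ (Ici 0) s :=
      (hasDerivAt_toLp_exp (μ := μ) ha.neg hna s).hasDerivWithinAt
    have h2 := (mulL μ).hasFDerivAt.comp_hasDerivWithinAt s h1
    have h3 := h2.clm_apply (hZ s hs)
    refine h3.congr_deriv ?_
    refine Lp.ext ?_
    filter_upwards [Lp.coeFn_add (mulL μ ((memLp_top_mul_exp (μ := μ) ha.neg hna s).toLp _) (Z s))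
      (mulL μ (E s) (mulL μ ((memLp_top_of_norm_le ha hK).toLp a) (Z s))),
      coeFn_mulL (memLp_top_mul_exp (μ := μ) ha.neg hna s) (Z s),
      coeFn_mulL (memLp_top_exp (μ := μ) ha.neg hna s)
        (mulL μ ((memLp_top_of_norm_le ha hK).toLp a) (Z s)),
      coeFn_mulL (memLp_top_of_norm_le (μ := μ) ha hK) (Z s), Lp.coeFn_zero ℂ 2 μ]
      with x h1 h2 h3 h4 h5
    refine h1.trans ?_
    rw [h5, Pi.add_apply, h2, h3, h4]
    simp only [Pi.neg_apply, Pi.zero_apply]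
    ring
  have hconst : mulL μ (E t) (Z t) = mulL μ (E 0) (Z 0) := by
    refine (convex_Ici (0 : ℝ)).is_const_of_fderivWithin_eq_zero (𝕜 := ℝ)
      (f := fun s => mulL μ (E s) (Z s))
      (fun s hs => (hder s hs).differentiableWithinAt) (fun s hs => ?_) ht self_mem_Ici
    have := (hder s hs).hasFDerivWithinAt.fderivWithin ((uniqueDiffOn_Ici 0) s hs)
    rw [this]; ext; simp
  have h1 := coeFn_mulL (memLp_top_exp (μ := μ) ha.neg hna t) (Z t)
  have h2 := coeFn_mulL (memLp_top_exp (μ := μ) ha.neg hna 0) (Z 0)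
  filter_upwards [h1, h2] with x h1 h2
  have h : Complex.exp (t * -a x) * Z t x = Complex.exp ((0 : ℝ) * -a x) * Z 0 x :=
    h1.symm.trans ((congrArg (fun F : Lp ℂ 2 μ => F x) hconst).trans h2)
  simp only [Complex.ofReal_zero, zero_mul, Complex.exp_zero, one_mul] at h
  rw [← h, ← mul_assoc, ← Complex.exp_add]
  simp

end Multiplier

/-! ### The equation in Fourier variables -/

variable {n : ℕ}

/-- The angular frequency `|ξ| = 2π ‖η‖` belonging to the variable `η` of `𝓕`. -/
noncomputable def angFreq (η : Space n) : ℝ := 2 * Real.pi * ‖η‖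

lemma continuous_angFreq : Continuous (angFreq (n := n)) := by
  unfold angFreq; fun_prop

/-- Multiplication of a Schwartz function by the symbol `-|ξ|²` of the Laplacian. -/
noncomputable def laplacianSymbolMul (ψ : 𝓢(Space n, ℂ)) : 𝓢(Space n, ℂ) :=
  (-(2 * Real.pi) ^ 2 : ℝ) •
    SchwartzMap.smulLeftCLM ℂ (fun x : Space n => Complex.ofReal (‖x‖ ^ 2)) ψ

lemma laplacianSymbolMul_apply (ψ : 𝓢(Space n, ℂ)) (η : Space n) :
    laplacianSymbolMul ψ η = -((angFreq η : ℂ) ^ 2) * ψ η := by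
  have hg : (fun x : Space n => Complex.ofReal (‖x‖ ^ 2)).HasTemperateGrowth := by fun_prop
  rw [laplacianSymbolMul, smul_apply, SchwartzMap.smulLeftCLM_apply_apply hg]
  simp only [angFreq, Complex.real_smul, smul_eq_mul]
  push_cast
  ring

/-- Testing against `𝓕 ψ` instead of `ψ` turns the distributional Laplacian into multiplication of
the test function by `-|ξ|²`. -/
lemma laplacian_apply_fourier (T : 𝓢'(Space n, ℂ)) (ψ : 𝓢(Space n, ℂ)) :
    (Δ T) (𝓕 ψ) = T (𝓕 (laplacianSymbolMul ψ)) := by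
  rw [TemperedDistribution.laplacian_eq_fourierMultiplierCLM,
    TemperedDistribution.fourierMultiplierCLM_apply]
  have h1 : 𝓕⁻ (TemperedDistribution.smulLeftCLM ℂ (fun x : Space n => Complex.ofReal (‖x‖ ^ 2))
      (𝓕 T)) (𝓕 ψ) =
      T (𝓕 (SchwartzMap.smulLeftCLM ℂ (fun x : Space n => Complex.ofReal (‖x‖ ^ 2)) ψ)) := by
    rw [TemperedDistribution.fourierInv_apply, TemperedDistribution.smulLeftCLM_apply_apply,
      TemperedDistribution.fourier_apply, FourierTransform.fourierInv_fourier_eq]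
  have h2 : ∀ (c : ℝ) (S : 𝓢'(Space n, ℂ)) (φ : 𝓢(Space n, ℂ)), (c • S) φ = c • S φ :=
    fun _ _ _ => rfl
  rw [h2, h1, laplacianSymbolMul, FourierTransform.fourier_smul]
  rw [← Complex.coe_smul (-(2 * Real.pi) ^ 2) (𝓕 _), map_smul, Complex.coe_smul]

lemma coe_apply_fourier (f : L2 n) (ψ : 𝓢(Space n, ℂ)) :
    (f : 𝓢'(Space n, ℂ)) (𝓕 ψ) = ((𝓕 f : L2 n) : 𝓢'(Space n, ℂ)) ψ := by
  rw [← TemperedDistribution.fourier_apply, Lp.fourier_toTemperedDistribution_eq]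

/-- Pairing with a fixed Schwartz function as a bounded functional on `L²`. -/
noncomputable def pairL (ψ : 𝓢(Space n, ℂ)) : L2 n →L[ℝ] ℂ :=
  ((PointwiseConvergenceCLM.evalCLM (RingHom.id ℂ) ℂ ψ).comp
    (Lp.toTemperedDistributionCLM ℂ (volume : Measure (Space n)) 2)).restrictScalars ℝ

lemma pairL_apply (ψ : 𝓢(Space n, ℂ)) (f : L2 n) :
    pairL ψ f = ∫ x, ψ x * f x := by
  have : pairL ψ f = (f : 𝓢'(Space n, ℂ)) ψ := rfl
  rw [this, Lp.toTemperedDistribution_apply]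
  rfl

lemma pairL_eq (ψ : 𝓢(Space n, ℂ)) (f : L2 n) :
    pairL ψ f = (f : 𝓢'(Space n, ℂ)) ψ := rfl

/-- The Fourier transform of `L²` as a real-linear bounded map. -/
noncomputable def fourierL (n : ℕ) : L2 n →L[ℝ] L2 n :=
  (FourierTransform.fourierCLM ℂ (L2 n)).restrictScalars ℝ

lemma integrable_schwartz_mul (ψ : 𝓢(Space n, ℂ)) (f : L2 n) :
    Integrable (fun x => ψ x * f x) :=
  MemLp.integrable_mul (ψ.memLp 2) (Lp.memLp f)

lemma locallyIntegrable_mul_L2 {w : Space n → ℂ} (hw : Continuous w) (f : L2 n) :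
    LocallyIntegrable (fun x => w x * f x) :=
  ((Lp.memLp f).locallyIntegrable one_le_two).continuous_mul hw

lemma exists_schwartz_eq_ofReal {g : Space n → ℝ} (hg : ContDiff ℝ (⊤ : ℕ∞) g)
    (hc : HasCompactSupport g) : ∃ ψ : 𝓢(Space n, ℂ), ∀ x, ψ x = (g x : ℂ) := by
  have hg₁ : HasCompactSupport (Complex.ofRealCLM ∘ g) := hc.comp_left rfl
  have hg₂ : ContDiff ℝ (⊤ : ℕ∞) (Complex.ofRealCLM ∘ g) := by fun_prop
  exact ⟨hg₁.toSchwartzMap hg₂, fun x => rfl⟩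

/-- The equation in Fourier variables, integrated in time. -/
lemma exists_fourier_identity {u v : ℝ → L2 n}
    (hu : ∀ t, 0 ≤ t → HasDerivWithinAt u (v t) (Ici 0) t)
    (heq : ∀ t, 0 ≤ t → ∀ φ : 𝓢(Space n, ℂ),
      HasDerivWithinAt (fun s => (v s : 𝓢'(Space n, ℂ)) φ)
        ((Δ (u t : 𝓢'(Space n, ℂ)) - Δ (Δ (v t : 𝓢'(Space n, ℂ)))) φ) (Ici 0) t) :
    ∃ I : ℝ → L2 n, (∀ t, 0 ≤ t → HasDerivWithinAt I (𝓕 (u t)) (Ici 0) t) ∧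
      ∀ t, 0 ≤ t → ∀ᵐ η : Space n,
        (𝓕 (v t) : L2 n) η = (𝓕 (v 0) : L2 n) η -
          (angFreq η : ℂ) ^ 4 * ((𝓕 (u t) : L2 n) η - (𝓕 (u 0) : L2 n) η)
          - (angFreq η : ℂ) ^ 2 * I t η := by
  set U : ℝ → L2 n := fun s => 𝓕 (u s) with hU
  set V : ℝ → L2 n := fun s => 𝓕 (v s) with hV
  have hUder : ∀ t, 0 ≤ t → HasDerivWithinAt U (V t) (Ici 0) t := fun t ht =>
    (fourierL n).hasFDerivAt.comp_hasDerivWithinAt t (hu t ht)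
  have hUc : ContinuousOn U (Ici 0) := fun t ht => (hUder t ht).continuousWithinAt
  -- `U` is controlled only for `s ≥ 0`. Freezing it at `U 0` for negative times makes the integrand
  -- continuous on the whole line.
  have hUc' : Continuous (fun s => U (max s 0)) :=
    hUc.comp_continuous (by fun_prop) (fun s => mem_Ici.2 (le_max_right s 0))
  refine ⟨fun t => ∫ s in (0 : ℝ)..t, U (max s 0), ?_, ?_⟩
  · intro t ht
    have h := (hUc'.integral_hasStrictDerivAt 0 t).hasDerivAt
    rw [max_eq_left ht] at h
    exact h.hasDerivWithinAt
  intro t ht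
  set I : ℝ → L2 n := fun t => ∫ s in (0 : ℝ)..t, U (max s 0) with hI
  have hIder : ∀ t, 0 ≤ t → HasDerivWithinAt I (U t) (Ici 0) t := by
    intro t ht
    have h := (hUc'.integral_hasStrictDerivAt 0 t).hasDerivAt
    rw [max_eq_left ht] at h
    exact h.hasDerivWithinAt
  have hI0 : I 0 = 0 := by simp [hI]
  -- The weak form of the conservation of `V + r⁴U + r²I`. No claim is made that `r⁴U` or `r²I` lies
  -- in `L²`: the symbols act on `ψ`.
  have hweak : ∀ ψ : 𝓢(Space n, ℂ), pairL ψ (V t) +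
      pairL (laplacianSymbolMul (laplacianSymbolMul ψ)) (U t) -
      pairL (laplacianSymbolMul ψ) (I t) = pairL ψ (V 0) +
      pairL (laplacianSymbolMul (laplacianSymbolMul ψ)) (U 0) := by
    intro ψ
    set G : ℝ → ℂ := fun s => pairL ψ (V s) +
      pairL (laplacianSymbolMul (laplacianSymbolMul ψ)) (U s) -
      pairL (laplacianSymbolMul ψ) (I s) with hG
    have hder : ∀ s ∈ Ici (0 : ℝ), HasDerivWithinAt G 0 (Ici 0) s := by
      intro s hs
      have h1 := heq s hs (𝓕 ψ)
      have e : ((Δ (u s : 𝓢'(Space n, ℂ)) - Δ (Δ (v s : 𝓢'(Space n, ℂ)))) (𝓕 ψ)) =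
          pairL (laplacianSymbolMul ψ) (U s) -
            pairL (laplacianSymbolMul (laplacianSymbolMul ψ)) (V s) := by
        have : ∀ (S T : 𝓢'(Space n, ℂ)) (φ : 𝓢(Space n, ℂ)), (S - T) φ = S φ - T φ :=
          fun _ _ _ => rfl
        rw [this, laplacian_apply_fourier, laplacian_apply_fourier, laplacian_apply_fourier,
          coe_apply_fourier, coe_apply_fourier]
        rfl
      simp only [coe_apply_fourier] at h1
      rw [e] at h1
      have h2 := (pairL (laplacianSymbolMul (laplacianSymbolMul ψ))).hasFDerivAt.comp_hasDerivWithinAt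
        s (hUder s hs)
      have h3 := (pairL (laplacianSymbolMul ψ)).hasFDerivAt.comp_hasDerivWithinAt
        s (hIder s hs)
      refine ((HasDerivWithinAt.add h1 h2).sub h3).congr_deriv ?_
      ring
    have hconst : G t = G 0 := by
      refine (convex_Ici (0 : ℝ)).is_const_of_fderivWithin_eq_zero (𝕜 := ℝ)
        (fun s hs => (hder s hs).differentiableWithinAt) (fun s hs => ?_) ht self_mem_Ici
      have := (hder s hs).hasFDerivWithinAt.fderivWithin ((uniqueDiffOn_Ici 0) s hs)
      rw [this]; ext; simp
    simpa [hG, hI0] using hconst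
  have hlocal : ∀ᵐ η : Space n, ((V t η + (angFreq η : ℂ) ^ 4 * U t η + (angFreq η : ℂ) ^ 2 * I t η)
      - (V 0 η + (angFreq η : ℂ) ^ 4 * U 0 η)) = 0 := by
    have c4 : Continuous (fun η : Space n => (angFreq η : ℂ) ^ 4) := by
      have := continuous_angFreq (n := n); fun_prop
    have c2 : Continuous (fun η : Space n => (angFreq η : ℂ) ^ 2) := by
      have := continuous_angFreq (n := n); fun_prop
    have l : ∀ f : L2 n, LocallyIntegrable (fun x : Space n => f x) := fun f =>
      (Lp.memLp f).locallyIntegrable one_le_two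
    refine ae_eq_zero_of_integral_contDiff_smul_eq_zero
      ((((l (V t)).add (locallyIntegrable_mul_L2 c4 (U t))).add
        (locallyIntegrable_mul_L2 c2 (I t))).sub
        ((l (V 0)).add (locallyIntegrable_mul_L2 c4 (U 0)))) ?_
    intro g g_smooth g_cpt
    obtain ⟨ψ, hψg⟩ := exists_schwartz_eq_ofReal g_smooth g_cpt
    have hw := hweak ψ
    simp only [pairL_apply] at hw
    have i1 := integrable_schwartz_mul ψ
    have i2 := integrable_schwartz_mul (laplacianSymbolMul ψ)
    have i3 := integrable_schwartz_mul (laplacianSymbolMul (laplacianSymbolMul ψ))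
    calc _ = ∫ x, ((ψ x * V t x + laplacianSymbolMul (laplacianSymbolMul ψ) x * U t x
            - laplacianSymbolMul ψ x * I t x) - (ψ x * V 0 x +
            laplacianSymbolMul (laplacianSymbolMul ψ) x * U 0 x)) := by
          refine integral_congr_ae (ae_of_all _ fun x => ?_)
          simp only [laplacianSymbolMul_apply, Complex.real_smul, ← hψg]
          ring
      _ = 0 := by
          have j1 : ∀ τ, Integrable (fun x => ψ x * V τ x +
              laplacianSymbolMul (laplacianSymbolMul ψ) x * U τ x) :=
            fun τ => (i1 _).add (i3 _)
          have j2 : Integrable (fun x => ψ x * V t x +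
              laplacianSymbolMul (laplacianSymbolMul ψ) x * U t x -
              laplacianSymbolMul ψ x * I t x) := (j1 t).sub (i2 _)
          rw [integral_sub j2 (j1 0), integral_sub (j1 t) (i2 _), integral_add (i1 _) (i3 _),
            integral_add (i1 _) (i3 _), hw, sub_self]
  filter_upwards [hlocal] with η h
  linear_combination h

/-! ### Frequency truncation and evolution of the modes -/

/-- Truncation of a symbol to a ball. -/
noncomputable def cutoff (N : ℕ) (w : Space n → ℂ) : Space n → ℂ :=
  (Metric.closedBall (0 : Space n) N).indicator w

lemma cutoff_of_mem {N : ℕ} {η : Space n} (h : ‖η‖ ≤ N) (w : Space n → ℂ) :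
    cutoff N w η = w η :=
  indicator_of_mem (by simpa using h) w

lemma cutoff_of_notMem {N : ℕ} {η : Space n} (h : ¬ ‖η‖ ≤ N) (w : Space n → ℂ) :
    cutoff N w η = 0 :=
  indicator_of_notMem (by simpa using h) w

lemma measurable_cutoff (N : ℕ) {w : Space n → ℂ} (hw : Continuous w) :
    Measurable (cutoff N w) :=
  hw.measurable.indicator Metric.isClosed_closedBall.measurableSet

lemma exists_norm_cutoff_le (N : ℕ) {w : Space n → ℂ} (hw : Continuous w) :
    ∃ K : ℝ, ∀ η, ‖cutoff N w η‖ ≤ K := by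
  obtain ⟨K, hK⟩ := (isCompact_closedBall (0 : Space n) (N : ℝ)).exists_bound_of_continuousOn
    hw.continuousOn
  refine ⟨max K 0, fun η => ?_⟩
  by_cases h : ‖η‖ ≤ N
  · rw [cutoff_of_mem h]
    exact (hK η (by simpa using h)).trans (le_max_left _ _)
  · rw [cutoff_of_notMem h, norm_zero]
    exact le_max_right _ _

lemma memLp_cutoff (N : ℕ) {w : Space n → ℂ} (hw : Continuous w) :
    MemLp (cutoff N w) ∞ (volume : Measure (Space n)) := by
  obtain ⟨K, hK⟩ := exists_norm_cutoff_le N hw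
  exact memLp_top_of_norm_le (measurable_cutoff N hw) hK

/-- The Fourier multiplier with a truncated continuous symbol. -/
noncomputable def cutL (N : ℕ) {w : Space n → ℂ} (hw : Continuous w) : L2 n →L[ℝ] L2 n :=
  mulL volume ((memLp_cutoff N hw).toLp _)

lemma coeFn_cutL (N : ℕ) {w : Space n → ℂ} (hw : Continuous w) (f : L2 n) :
    cutL N hw f =ᵐ[volume] fun η => cutoff N w η * f η :=
  coeFn_mulL (memLp_cutoff N hw) f

lemma continuous_charRoot_angFreq (s : ℝ) :
    Continuous (fun η : Space n => charRoot s (angFreq η)) :=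
  (continuous_charRoot s).comp continuous_angFreq

lemma continuous_angFreq_pow (k : ℕ) : Continuous (fun η : Space n => (angFreq η : ℂ) ^ k) := by
  have := continuous_angFreq (n := n); fun_prop

/-- Each mode `u_t - λ₋ u` evolves by `exp (t λ₊)`. -/
lemma modes_evolution {U V I : ℝ → L2 n}
    (hU : ∀ t, 0 ≤ t → HasDerivWithinAt U (V t) (Ici 0) t)
    (hI : ∀ t, 0 ≤ t → HasDerivWithinAt I (U t) (Ici 0) t)
    (hid : ∀ t, 0 ≤ t → ∀ᵐ η : Space n, V t η = V 0 η -
          (angFreq η : ℂ) ^ 4 * (U t η - U 0 η) - (angFreq η : ℂ) ^ 2 * I t η)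
    {s : ℝ} (hs : s ^ 2 = 1) {t : ℝ} (ht : 0 ≤ t) :
    ∀ᵐ η : Space n, V t η - charRoot (-s) (angFreq η) * U t η =
      Complex.exp (t * charRoot s (angFreq η)) *
        (V 0 η - charRoot (-s) (angFreq η) * U 0 η) := by
  have hone : Continuous (fun _ : Space n => (1 : ℂ)) := continuous_const
  have hm := continuous_charRoot_angFreq (n := n) (-s)
  have hp := continuous_charRoot_angFreq (n := n) s
  have h4 := continuous_angFreq_pow (n := n) 4
  have h2 := continuous_angFreq_pow (n := n) 2
  have key : ∀ N : ℕ, ∀ᵐ η : Space n, ‖η‖ ≤ N →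
      V t η - charRoot (-s) (angFreq η) * U t η =
      Complex.exp (t * charRoot s (angFreq η)) *
        (V 0 η - charRoot (-s) (angFreq η) * U 0 η) := by
    intro N
    obtain ⟨K, hK⟩ := exists_norm_cutoff_le N hp
    set Z : ℝ → L2 n := fun τ => cutL N hone (V τ) - cutL N hm (U τ) with hZ
    have hZapply : ∀ τ, ∀ᵐ η : Space n, Z τ η =
        cutoff N (fun _ => 1) η * V τ η -
          cutoff N (fun η => charRoot (-s) (angFreq η)) η * U τ η := by
      intro τ
      filter_upwards [Lp.coeFn_sub (cutL N hone (V τ)) (cutL N hm (U τ)),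
        coeFn_cutL N hone (V τ), coeFn_cutL N hm (U τ)] with η e1 e2 e3
      refine e1.trans ?_
      rw [Pi.sub_apply, e2, e3]
    have hZder : ∀ τ, 0 ≤ τ → HasDerivWithinAt Z
        (mulL volume ((memLp_top_of_norm_le (measurable_cutoff N hp) hK).toLp _) (Z τ))
        (Ici 0) τ := by
      intro τ hτ
      -- `V` itself is not known to be differentiable in `L²`; the integrated identity expresses its
      -- truncation through `U` and `I`, which are.
      have hW : ∀ σ ∈ Ici (0 : ℝ), Z σ = cutL N hone (V 0) - cutL N h4 (U σ - U 0)
          - cutL N h2 (I σ) - cutL N hm (U σ) := by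
        intro σ hσ
        have : cutL N hone (V σ) =
            cutL N hone (V 0) - cutL N h4 (U σ - U 0) - cutL N h2 (I σ) := by
          refine Lp.ext ?_
          filter_upwards [hid σ hσ, coeFn_cutL N hone (V σ), coeFn_cutL N hone (V 0),
            coeFn_cutL N h4 (U σ - U 0), coeFn_cutL N h2 (I σ), Lp.coeFn_sub (U σ) (U 0),
            Lp.coeFn_sub (cutL N hone (V 0)) (cutL N h4 (U σ - U 0)),
            Lp.coeFn_sub (cutL N hone (V 0) - cutL N h4 (U σ - U 0)) (cutL N h2 (I σ))]
            with η e0 e1 e2 e3 e4 e5 e6 e7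
          rw [e1, e7, Pi.sub_apply, e6, Pi.sub_apply, e2, e3, e4, e5, Pi.sub_apply, e0]
          by_cases h : ‖η‖ ≤ N
          · simp only [cutoff_of_mem h]; ring
          · simp only [cutoff_of_notMem h]; ring
        simp only [hZ, this]
      have d4 := (cutL N h4).hasFDerivAt.comp_hasDerivWithinAt τ ((hU τ hτ).sub_const (U 0))
      have d2 := (cutL N h2).hasFDerivAt.comp_hasDerivWithinAt τ (hI τ hτ)
      have dm := (cutL N hm).hasFDerivAt.comp_hasDerivWithinAt τ (hU τ hτ)
      have dW := ((((hasDerivWithinAt_const τ (Ici 0) (cutL N hone (V 0))).sub d4).sub d2).sub dm)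
      refine (dW.congr hW (hW τ hτ)).congr_deriv ?_
      refine Lp.ext ?_
      filter_upwards [hZapply τ,
        coeFn_mulL (memLp_top_of_norm_le (measurable_cutoff N hp) hK) (Z τ),
        Lp.coeFn_sub (0 - cutL N h4 (V τ) - cutL N h2 (U τ)) (cutL N hm (V τ)),
        Lp.coeFn_sub (0 - cutL N h4 (V τ)) (cutL N h2 (U τ)),
        Lp.coeFn_sub 0 (cutL N h4 (V τ)), Lp.coeFn_zero ℂ 2 (volume : Measure (Space n)),
        coeFn_cutL N h4 (V τ), coeFn_cutL N h2 (U τ), coeFn_cutL N hm (V τ)]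
        with η e1 e2 e3 e4 e5 e6 e7 e8 e9
      refine e3.trans ?_
      rw [e2, e1, Pi.sub_apply, e4, Pi.sub_apply, e5, Pi.sub_apply, e6, Pi.zero_apply, e7, e8, e9]
      by_cases h : ‖η‖ ≤ N
      · simp only [cutoff_of_mem h]
        -- Vieta: `-r⁴V - r²U - λ₋V = λ₊(V - λ₋U)`.
        linear_combination -(V τ η) * charRoot_add s (angFreq η) +
          U τ η * charRoot_mul hs (angFreq η)
      · simp only [cutoff_of_notMem h]; ring
    filter_upwards [ae_eq_exp_mul_of_hasDerivWithinAt (measurable_cutoff N hp) hK hZder ht,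
      hZapply t, hZapply 0] with η e1 e2 e3 hη
    rw [e2, e3] at e1
    simpa only [cutoff_of_mem hη, one_mul] using e1
  filter_upwards [ae_all_iff.2 key] with η h
  obtain ⟨N, hN⟩ := exists_nat_ge ‖η‖
  exact h N hN

/-! ### Fourier transforms of the data and Sobolev norms -/

/-- On `L¹ ∩ L²` the Fourier transform of `L²` is given by the Fourier integral. -/
lemma fourier_ae_eq_fourierIntegral {f : L2 n} (hf : Integrable (fun x => f x)) :
    ∀ᵐ η : Space n, (𝓕 f : L2 n) η = 𝓕 (fun x => f x) η := by
  have hcont : Continuous (𝓕 (fun x => f x) : Space n → ℂ) :=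
    VectorFourier.fourierIntegral_continuous Real.continuous_fourierChar continuous_inner hf
  have hbound : ∀ η, ‖𝓕 (fun x => f x) η‖ ≤ ∫ x, ‖f x‖ := fun η =>
    VectorFourier.norm_fourierIntegral_le_integral_norm _ _ _ _ _
  have h : ∀ᵐ η : Space n, (𝓕 f : L2 n) η - 𝓕 (fun x => f x) η = 0 := by
    refine ae_eq_zero_of_integral_contDiff_smul_eq_zero
      (((Lp.memLp (𝓕 f : L2 n)).locallyIntegrable one_le_two).sub hcont.locallyIntegrable) ?_
    intro g hg hc
    obtain ⟨ψ, hψ⟩ := exists_schwartz_eq_ofReal hg hc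
    have h1 : ∫ x, ψ x * (𝓕 f : L2 n) x = ∫ x, 𝓕 ψ x * f x := by
      rw [← pairL_apply, ← pairL_apply, pairL_eq, pairL_eq, ← coe_apply_fourier]
    have h2 : ∫ x, 𝓕 ψ x * f x = ∫ x, ψ x * 𝓕 (fun x => f x) x := by
      have := VectorFourier.integral_fourierIntegral_smul_eq_flip (L := innerₗ (Space n))
        (μ := volume) (ν := volume) Real.continuous_fourierChar continuous_inner ψ.integrable hf
      simpa [SchwartzMap.fourier_coe] using! this
    have i2 : Integrable (fun x => ψ x * 𝓕 (fun x => f x) x) :=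
      ψ.integrable.mul_bdd hcont.aestronglyMeasurable (ae_of_all _ hbound)
    calc _ = ∫ x, (ψ x * (𝓕 f : L2 n) x - ψ x * 𝓕 (fun x => f x) x) := by
          refine integral_congr_ae (ae_of_all _ fun x => ?_)
          simp only [Complex.real_smul, ← hψ]
          ring
      _ = 0 := by rw [integral_sub (integrable_schwartz_mul ψ _) i2, h1, h2, sub_self]
  filter_upwards [h] with η hη using sub_eq_zero.1 hη

lemma norm_fourier_le_integral_norm {f : L2 n} (hf : Integrable (fun x => f x)) :
    ∀ᵐ η : Space n, ‖(𝓕 f : L2 n) η‖ ≤ ∫ x, ‖f x‖ := by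
  filter_upwards [fourier_ae_eq_fourierIntegral hf] with η hη
  rw [hη]
  exact VectorFourier.norm_fourierIntegral_le_integral_norm _ _ _ _ _

lemma integral_norm_le_weightedL1Norm {γ : ℝ} (hγ : 0 ≤ γ) {f : L2 n} (hf : MemWeightedL1 γ f) :
    ∫ x, ‖f x‖ ≤ weightedL1Norm γ f := by
  refine integral_mono hf.1.norm hf.2 (fun x => ?_)
  have : 1 ≤ (1 + ‖x‖) ^ γ := Real.one_le_rpow (by linarith [norm_nonneg x]) hγ
  exact le_mul_of_one_le_left (norm_nonneg _) this

/-- The normalizing constant, squared, is the Jacobian of `ξ = 2πη`, so the Sobolev integral carries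
over to the variable `η` without a constant. -/
lemma sobolev_weight_comp (p : ℝ) (f : L2 n) :
    (fun ξ : Space n => (1 + ‖ξ‖ ^ (2 * p)) * ‖fourierHat f ξ‖ ^ 2) =
    fun ξ : Space n => ((2 * Real.pi) ^ n)⁻¹ *
      (fun η : Space n => (1 + angFreq η ^ (2 * p)) * ‖(𝓕 f : L2 n) η‖ ^ 2)
        ((2 * Real.pi)⁻¹ • ξ) := by
  have hpi : (0 : ℝ) < 2 * Real.pi := by positivity
  funext ξ
  have h1 : angFreq ((2 * Real.pi)⁻¹ • ξ) = ‖ξ‖ := by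
    rw [angFreq, norm_smul, Real.norm_eq_abs, abs_of_pos (inv_pos.2 hpi)]
    field_simp
  have h2 : ((2 * Real.pi) ^ (-(n : ℝ) / 2)) ^ 2 = ((2 * Real.pi) ^ n)⁻¹ := by
    rw [← Real.rpow_natCast, ← Real.rpow_mul hpi.le, ← Real.rpow_natCast (2 * Real.pi) n,
      ← Real.rpow_neg hpi.le]
    congr 1; push_cast; ring
  simp only [h1, fourierHat, norm_mul, mul_pow, Complex.norm_real, Real.norm_eq_abs, sq_abs, h2]
  ring

lemma integrable_sobolev {p : ℝ} {f : L2 n} (hf : MemHSobolev p f) :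
    Integrable (fun η : Space n => (1 + angFreq η ^ (2 * p)) * ‖(𝓕 f : L2 n) η‖ ^ 2) := by
  have hpi : (0 : ℝ) < 2 * Real.pi := by positivity
  unfold MemHSobolev at hf
  rw [sobolev_weight_comp, integrable_const_mul_iff (by
    rw [isUnit_iff_ne_zero]; positivity)] at hf
  exact (integrable_comp_smul_iff volume _ (inv_pos.2 hpi).ne').1 hf

lemma integral_sobolev (p : ℝ) (f : L2 n) :
    ∫ η : Space n, (1 + angFreq η ^ (2 * p)) * ‖(𝓕 f : L2 n) η‖ ^ 2 = hSobolevNorm p f ^ 2 := by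
  have hpi : (0 : ℝ) < 2 * Real.pi := by positivity
  rw [hSobolevNorm, Real.sq_sqrt (integral_nonneg fun ξ => by positivity), sobolev_weight_comp,
    integral_const_mul, Measure.integral_comp_smul volume
      (fun η : Space n => (1 + angFreq η ^ (2 * p)) * ‖(𝓕 f : L2 n) η‖ ^ 2), finrank_euclideanSpace_fin, smul_eq_mul,
    inv_pow, inv_inv, abs_of_pos (by positivity), ← mul_assoc, inv_mul_cancel₀ (by positivity),
    one_mul]

lemma norm_sq_eq_integral_fourier (f : L2 n) :
    ‖f‖ ^ 2 = ∫ η : Space n, ‖(𝓕 f : L2 n) η‖ ^ 2 := by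
  rw [← Lp.norm_fourier_eq f, @norm_sq_eq_re_inner ℂ, L2.inner_def]
  simp only [inner_self_eq_norm_sq_to_K]
  norm_cast

/-! ### Low-frequency integrals and the diffusion rate -/

/-- Polar coordinates reduce the integral to a Gamma function; `0 < n + k` is integrability at the
origin. The exponents used are `k = 0` for `u₀` and `k = -2` for `u₁`. -/
lemma integrable_and_integral_le_exp_quartic (hn : 1 ≤ n) {k : ℝ} (hk : 0 < n + k) :
    ∃ C : ℝ, 0 ≤ C ∧ ∀ t : ℝ, 0 < t →
      Integrable (fun η : Space n => ‖η‖ ^ k * Real.exp (-t * ‖η‖ ^ (4 : ℝ))) ∧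
      ∫ η : Space n, ‖η‖ ^ k * Real.exp (-t * ‖η‖ ^ (4 : ℝ)) = C * t ^ (-((n : ℝ) + k) / 4) := by
  have : Nonempty (Fin n) := ⟨⟨0, hn⟩⟩
  set B := (volume : Measure (Space n)).real (Metric.ball 0 1) with hB
  have hfun : ∀ t : ℝ, EqOn (fun y : ℝ => y ^ ((n : ℝ) - 1 + k) * Real.exp (-t * y ^ (4 : ℝ)))
      (fun y : ℝ => y ^ (n - 1) • (y ^ k * Real.exp (-t * y ^ (4 : ℝ)))) (Ioi 0) := by
    intro t y hy
    have hy : 0 < y := hy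
    simp only [smul_eq_mul]
    rw [Real.rpow_add hy, ← Nat.cast_one, ← Nat.cast_sub hn, Real.rpow_natCast, mul_assoc]
  refine ⟨n * (B * (1 / 4 * Real.Gamma ((n + k) / 4))), ?_, fun t ht => ⟨?_, ?_⟩⟩
  · have : 0 ≤ Real.Gamma ((n + k) / 4) := (Real.Gamma_pos_of_pos (by positivity)).le
    positivity
  · rw [integrable_fun_norm_addHaar (volume : Measure (Space n))
      (f := fun y : ℝ => y ^ k * Real.exp (-t * y ^ (4 : ℝ))), finrank_euclideanSpace_fin]
    exact (integrableOn_rpow_mul_exp_neg_mul_rpow (by linarith) (by norm_num) ht).congr_fun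
      (hfun t) measurableSet_Ioi
  · rw [integral_fun_norm_addHaar (volume : Measure (Space n))
      (fun y : ℝ => y ^ k * Real.exp (-t * y ^ (4 : ℝ))), finrank_euclideanSpace_fin,
      ← setIntegral_congr_fun measurableSet_Ioi (hfun t),
      integral_rpow_mul_exp_neg_mul_rpow (by norm_num) (by linarith) ht, nsmul_eq_mul, smul_eq_mul]
    rw [show (n : ℝ) - 1 + k + 1 = n + k by ring]
    ring

lemma diffusionRate_one (t : ℝ) : diffusionRate 1 t = Real.sqrt t := by simp [diffusionRate]

lemma diffusionRate_two (t : ℝ) : diffusionRate 2 t = Real.sqrt (Real.log t) := by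
  simp [diffusionRate]

lemma diffusionRate_of_three_le (hn : 3 ≤ n) (t : ℝ) :
    diffusionRate n t = t ^ (-(n : ℝ) / 8 + 1 / 4) := by
  have h1 : n ≠ 1 := by omega
  have h2 : n ≠ 2 := by omega
  simp [diffusionRate, h1, h2]

lemma diffusionRate_sq_of_three_le (hn : 3 ≤ n) {t : ℝ} (ht : 0 < t) :
    diffusionRate n t ^ 2 = t ^ (-(n : ℝ) / 4 + 1 / 2) := by
  rw [diffusionRate_of_three_le hn, ← Real.rpow_natCast, ← Real.rpow_mul ht.le]
  congr 1; push_cast; ring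

lemma diffusionRate_nonneg {t : ℝ} (ht : 0 ≤ t) : 0 ≤ diffusionRate n t := by
  unfold diffusionRate; split_ifs <;> positivity

/-- Powers of `t` that are not larger than the diffusion rate. -/
lemma rpow_le_diffusionRate_sq (hn : 1 ≤ n) {q t : ℝ} (hq0 : q ≤ 0)
    (hq : 3 ≤ n → q ≤ -(n : ℝ) / 4 + 1 / 2) (ht : 2 ≤ t) :
    t ^ q ≤ 2 * diffusionRate n t ^ 2 := by
  have h1 : t ^ q ≤ 1 := Real.rpow_le_one_of_one_le_of_nonpos (by linarith) hq0
  obtain rfl | rfl | h3 : n = 1 ∨ n = 2 ∨ 3 ≤ n := by omega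
  · rw [diffusionRate_one, Real.sq_sqrt (by linarith)]; linarith
  · have : Real.log 2 ≤ Real.log t := Real.log_le_log (by norm_num) ht
    -- The factor 2 in the claim is due to this case: `log 2 < 1`, but `1 ≤ 2 log 2`.
    have h2 := Real.log_two_gt_d9
    rw [diffusionRate_two, Real.sq_sqrt (by linarith)]
    linarith
  · rw [diffusionRate_sq_of_three_le h3 (by linarith)]
    have : t ^ q ≤ t ^ (-(n : ℝ) / 4 + 1 / 2) :=
      Real.rpow_le_rpow_of_exponent_le (by linarith) (hq h3)
    have h0 : 0 ≤ t ^ (-(n : ℝ) / 4 + 1 / 2) := by positivity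
    linarith

lemma integrable_rational_majorant_one {t : ℝ} (ht : 2 ≤ t) :
    Integrable (fun η : Space 1 => 2 * t ^ 2 / (1 + t ^ 2 * ‖η‖ ^ 2)) ∧
    ∫ η : Space 1, 2 * t ^ 2 / (1 + t ^ 2 * ‖η‖ ^ 2) =
      (volume : Measure (Space 1)).real (Metric.ball 0 1) * (Real.pi * t) := by
  have ht0 : 0 < t := by linarith
  have hfun : ∀ y : ℝ, 2 * t ^ 2 / (1 + t ^ 2 * y ^ 2) = 2 * t ^ 2 * (1 + (t * y) ^ 2)⁻¹ := by
    intro y; rw [div_eq_mul_inv, mul_pow]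
  constructor
  · rw [integrable_fun_norm_addHaar (volume : Measure (Space 1))
      (f := fun y : ℝ => 2 * t ^ 2 / (1 + t ^ 2 * y ^ 2)), finrank_euclideanSpace_fin]
    simp only [hfun, Nat.sub_self, pow_zero, one_smul]
    exact ((integrable_inv_one_add_sq.comp_mul_left' ht0.ne').const_mul _).integrableOn
  · rw [integral_fun_norm_addHaar (volume : Measure (Space 1))
      (fun y : ℝ => 2 * t ^ 2 / (1 + t ^ 2 * y ^ 2)), finrank_euclideanSpace_fin]
    simp only [hfun, Nat.sub_self, pow_zero, one_smul]
    rw [integral_const_mul, integral_comp_mul_left_Ioi (fun y => (1 + y ^ 2)⁻¹) 0 ht0, mul_zero,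
      integral_Ioi_inv_one_add_sq, Real.arctan_zero, smul_eq_mul, smul_eq_mul]
    field_simp
    ring

/-- In the plane the radial integrand behaves like `1/y` at infinity, hence the cutoff at 1; its
primitive is `log(1 + t²y²)`. -/
lemma integrable_rational_majorant_two {t : ℝ} (ht : 2 ≤ t) :
    Integrable (fun η : Space 2 =>
      (Iic (1 : ℝ)).indicator (fun y => 2 * t ^ 2 / (1 + t ^ 2 * y ^ 2)) ‖η‖) ∧
    ∫ η : Space 2, (Iic (1 : ℝ)).indicator (fun y => 2 * t ^ 2 / (1 + t ^ 2 * y ^ 2)) ‖η‖ =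
      2 * ((volume : Measure (Space 2)).real (Metric.ball 0 1) * Real.log (1 + t ^ 2)) := by
  have hpos : ∀ y : ℝ, 0 < 1 + t ^ 2 * y ^ 2 := fun y => by positivity
  have hcont : Continuous (fun y : ℝ => 2 * t ^ 2 * y / (1 + t ^ 2 * y ^ 2)) :=
    Continuous.div₀ (by fun_prop) (by fun_prop) (fun y => (hpos y).ne')
  have hfun : (fun y : ℝ => y ^ (2 - 1) •
      (Iic (1 : ℝ)).indicator (fun y => 2 * t ^ 2 / (1 + t ^ 2 * y ^ 2)) y) =
      (Iic (1 : ℝ)).indicator (fun y => 2 * t ^ 2 * y / (1 + t ^ 2 * y ^ 2)) := by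
    funext y
    by_cases hy : y ∈ Iic (1 : ℝ)
    · rw [indicator_of_mem hy, indicator_of_mem hy]; simp; ring
    · rw [indicator_of_notMem hy, indicator_of_notMem hy]; simp
  have hset : Ioi (0 : ℝ) ∩ Iic 1 = Ioc 0 1 := rfl
  constructor
  · rw [integrable_fun_norm_addHaar (volume : Measure (Space 2))
      (f := (Iic (1 : ℝ)).indicator (fun y => 2 * t ^ 2 / (1 + t ^ 2 * y ^ 2))),
      finrank_euclideanSpace_fin, hfun, integrableOn_indicator_iff measurableSet_Iic,
      inter_comm, hset]
    exact hcont.integrableOn_Ioc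
  · rw [integral_fun_norm_addHaar (volume : Measure (Space 2))
      ((Iic (1 : ℝ)).indicator (fun y => 2 * t ^ 2 / (1 + t ^ 2 * y ^ 2))),
      finrank_euclideanSpace_fin, hfun, setIntegral_indicator measurableSet_Iic, hset,
      ← intervalIntegral.integral_of_le zero_le_one]
    rw [intervalIntegral.integral_eq_sub_of_hasDerivAt
      (f := fun y => Real.log (1 + t ^ 2 * y ^ 2)) (fun y _ => ?_)
      (hcont.intervalIntegrable 0 1)]
    · simp
    · have h1 : HasDerivAt (fun y : ℝ => 1 + t ^ 2 * y ^ 2) (t ^ 2 * (2 * y)) y := by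
        simpa using ((hasDerivAt_pow 2 y).const_mul (t ^ 2)).const_add 1
      convert! h1.log (hpos y).ne' using 1
      ring

/-- The rational majorant of `min t x⁻¹ ^ 2`. -/
lemma min_sq_le {t x : ℝ} (ht : 0 < t) (hx : 0 < x) :
    min t x⁻¹ ^ 2 ≤ 2 * t ^ 2 / (1 + t ^ 2 * x ^ 2) := by
  have hm : 0 ≤ min t x⁻¹ := by positivity
  have h1 : min t x⁻¹ ^ 2 ≤ t ^ 2 := by gcongr; exact min_le_left _ _
  have h2 : min t x⁻¹ * x ≤ 1 := by
    calc min t x⁻¹ * x ≤ x⁻¹ * x := by gcongr; exact min_le_right _ _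
      _ = 1 := inv_mul_cancel₀ hx.ne'
  have h3 : (min t x⁻¹ * x) ^ 2 ≤ 1 := pow_le_one₀ (by positivity) h2
  rw [le_div_iff₀ (by positivity)]
  have : t ^ 2 * (min t x⁻¹ * x) ^ 2 ≤ t ^ 2 * 1 := by gcongr
  nlinarith

lemma norm_le_angFreq (η : Space n) : ‖η‖ ≤ angFreq η := by
  unfold angFreq; nlinarith [norm_nonneg η, Real.pi_gt_three]

lemma exp_angFreq_le {t : ℝ} (ht : 0 ≤ t) (η : Space n) :
    Real.exp (-(angFreq η ^ 4 / 2) * t) ≤ Real.exp (-t * ‖η‖ ^ (4 : ℝ)) := by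
  rw [Real.exp_le_exp, show (4 : ℝ) = ((4 : ℕ) : ℝ) by norm_num, Real.rpow_natCast]
  have h2 : 2 * ‖η‖ ≤ angFreq η := by
    unfold angFreq; nlinarith [norm_nonneg η, Real.pi_gt_three]
  have h4 : (2 * ‖η‖) ^ 4 ≤ angFreq η ^ 4 := by gcongr
  have : ‖η‖ ^ 4 ≤ angFreq η ^ 4 / 2 := by nlinarith [pow_nonneg (norm_nonneg η) 4]
  nlinarith

/-- A majorant of the low-frequency kernel of `u₁` with the right integral. -/
lemma exists_low_majorant_velocity (hn : 1 ≤ n) :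
    ∃ C : ℝ, 0 ≤ C ∧ ∀ t : ℝ, 2 ≤ t → ∃ g : Space n → ℝ, Integrable g ∧ (∀ η, 0 ≤ g η) ∧
      (∀ η : Space n, η ≠ 0 → angFreq η ≤ 1 →
        Real.exp (-(angFreq η ^ 4 / 2) * t) * min t (2 / angFreq η) ^ 2 ≤ g η) ∧
      ∫ η, g η ≤ C * diffusionRate n t ^ 2 := by
  have hmin : ∀ (t : ℝ), 0 < t → ∀ η : Space n, η ≠ 0 →
      min t (2 / angFreq η) ^ 2 ≤ min t ‖η‖⁻¹ ^ 2 := by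
    intro t ht η hη
    have h0 : 0 < ‖η‖ := norm_pos_iff.2 hη
    have ha : 0 < angFreq η := h0.trans_le (norm_le_angFreq η)
    have : 2 / angFreq η ≤ ‖η‖⁻¹ := by
      rw [angFreq, div_le_iff₀ (by positivity)]
      field_simp
      exact Real.pi_gt_three.le.trans' (by norm_num)
    gcongr
  have hexp1 : ∀ t : ℝ, 0 ≤ t → ∀ η : Space n, Real.exp (-(angFreq η ^ 4 / 2) * t) ≤ 1 := by
    intro t ht η
    rw [Real.exp_le_one_iff]
    have : 0 ≤ angFreq η ^ 4 / 2 := by positivity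
    nlinarith
  obtain rfl | rfl | h3 : n = 1 ∨ n = 2 ∨ 3 ≤ n := by omega
  -- For `n = 1, 2` the minimum with `t` alone gives the rate, and the damping is estimated by 1.
  · refine ⟨(volume : Measure (Space 1)).real (Metric.ball 0 1) * Real.pi, by positivity,
      fun t ht => ⟨_, (integrable_rational_majorant_one ht).1, fun η => by positivity,
        fun η hη h1 => ?_, ?_⟩⟩
    · have h := (hmin t (by linarith) η hη).trans
        (min_sq_le (by linarith) (norm_pos_iff.2 hη))
      exact (mul_le_of_le_one_left (by positivity) (hexp1 t (by linarith) η)).trans h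
    · rw [(integrable_rational_majorant_one ht).2, diffusionRate_one,
        Real.sq_sqrt (by linarith), mul_assoc]
  · refine ⟨2 * ((volume : Measure (Space 2)).real (Metric.ball 0 1) * 3), by positivity,
      fun t ht => ⟨_, (integrable_rational_majorant_two ht).1,
        fun η => indicator_nonneg (fun y _ => by positivity) _, fun η hη h1 => ?_, ?_⟩⟩
    · have h := (hmin t (by linarith) η hη).trans
        (min_sq_le (by linarith) (norm_pos_iff.2 hη))
      rw [indicator_of_mem (mem_Iic.2 ((norm_le_angFreq η).trans h1))]
      exact (mul_le_of_le_one_left (by positivity) (hexp1 t (by linarith) η)).trans h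
    · have hlog : Real.log (1 + t ^ 2) ≤ 3 * Real.log t := by
        rw [← Real.log_rpow (by linarith)]
        apply Real.log_le_log (by positivity)
        rw [show (3 : ℝ) = ((3 : ℕ) : ℝ) by norm_num, Real.rpow_natCast]
        nlinarith [sq_nonneg t]
      have hl0 : 0 ≤ Real.log t := Real.log_nonneg (by linarith)
      rw [(integrable_rational_majorant_two ht).2, diffusionRate_two, Real.sq_sqrt hl0]
      calc _ ≤ 2 * ((volume : Measure (Space 2)).real (Metric.ball 0 1) * (3 * Real.log t)) := by
            gcongr
        _ = _ := by ring
  -- For `n ≥ 3` the singularity `‖η‖⁻²` is integrable, so the minimum with `t` is dropped and the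
  -- damping gives the decay.
  · have hk : 0 < (n : ℝ) + (-2) := by
      have : (3 : ℝ) ≤ n := by exact_mod_cast h3
      linarith
    obtain ⟨C, hC, h⟩ := integrable_and_integral_le_exp_quartic hn hk
    refine ⟨C, hC, fun t ht => ⟨_, (h t (by linarith)).1, fun η => by positivity,
      fun η hη h1 => ?_, ?_⟩⟩
    · have h0 : 0 < ‖η‖ := norm_pos_iff.2 hη
      have h2 : min t (2 / angFreq η) ^ 2 ≤ ‖η‖ ^ (-2 : ℝ) := by
        refine (hmin t (by linarith) η hη).trans ?_
        rw [Real.rpow_neg h0.le, show (2 : ℝ) = ((2 : ℕ) : ℝ) by norm_num, Real.rpow_natCast,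
          ← inv_pow]
        have : 0 ≤ min t ‖η‖⁻¹ := le_min (by linarith) (inv_nonneg.2 h0.le)
        gcongr
        exact min_le_right _ _
      rw [mul_comm]
      exact mul_le_mul h2 (exp_angFreq_le (by linarith) η) (Real.exp_pos _).le (by positivity)
    · rw [(h t (by linarith)).2, diffusionRate_sq_of_three_le h3 (by linarith)]
      apply le_of_eq
      congr 2; ring

/-- A majorant of the low-frequency kernel of `u₀`. -/
lemma exists_low_majorant_position (hn : 1 ≤ n) :
    ∃ C : ℝ, 0 ≤ C ∧ ∀ t : ℝ, 2 ≤ t → ∃ g : Space n → ℝ, Integrable g ∧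
      (∀ η : Space n, Real.exp (-(angFreq η ^ 4 / 2) * t) ≤ g η) ∧
      ∫ η, g η ≤ C * diffusionRate n t ^ 2 := by
  have hk : 0 < (n : ℝ) + 0 := by
    have : (1 : ℝ) ≤ n := by exact_mod_cast hn
    linarith
  obtain ⟨C, hC, h⟩ := integrable_and_integral_le_exp_quartic hn hk
  refine ⟨C * 2, by positivity, fun t ht => ⟨_, (h t (by linarith)).1, fun η => ?_, ?_⟩⟩
  · rw [Real.rpow_zero, one_mul]
    exact exp_angFreq_le (by linarith) η
  · rw [(h t (by linarith)).2, mul_assoc]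
    gcongr
    refine rpow_le_diffusionRate_sq hn ?_ ?_ ht <;> intros <;> linarith

/-! ### High-frequency decay and the exceptional frequencies -/

/-- Raise `x/(2s) ≤ e^{x/(2s)}` to the power `s`. -/
lemma exp_neg_half_le {s x : ℝ} (hs : 0 < s) (hx : 0 < x) :
    Real.exp (-x / 2) ≤ (2 * s) ^ s * x ^ (-s) := by
  have h1 : x ≤ 2 * s * Real.exp (x / (2 * s)) := by
    have := Real.add_one_le_exp (x / (2 * s))
    rw [← div_le_iff₀' (by positivity)]
    linarith
  have h2 : x ^ s ≤ (2 * s) ^ s * Real.exp (x / 2) := by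
    calc x ^ s ≤ (2 * s * Real.exp (x / (2 * s))) ^ s := by gcongr
      _ = _ := by
        rw [Real.mul_rpow (by positivity) (by positivity), ← Real.exp_mul]
        congr 2; field_simp
  rw [Real.rpow_neg hx.le, ← div_eq_mul_inv, le_div_iff₀ (by positivity), neg_div, Real.exp_neg,
    inv_mul_le_iff₀ (Real.exp_pos _), mul_comm]
  exact h2

/-- Decay at high frequencies, paid for with regularity. -/
lemma exp_neg_div_sq_le {l r t : ℝ} (hl : 0 ≤ l) (hr : 0 < r) (ht : 0 < t) :
    Real.exp (-t / (2 * r ^ 2)) ≤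
      (2 * (l + 1)) ^ (l + 1) * t ^ (-(l + 1)) * r ^ (2 * (l + 1)) := by
  have h := exp_neg_half_le (s := l + 1) (x := t / r ^ 2) (by linarith) (by positivity)
  have e : (t / r ^ 2) ^ (-(l + 1)) = t ^ (-(l + 1)) * r ^ (2 * (l + 1)) := by
    rw [Real.div_rpow ht.le (by positivity), ← Real.rpow_natCast r 2, ← Real.rpow_mul hr.le,
      div_eq_mul_inv, ← Real.rpow_neg hr.le]
    congr 2; push_cast; ring
  rw [e, ← mul_assoc] at h
  convert! h using 2
  field_simp

/-- The kernels divide by the gap of the roots, which vanishes only at the origin and on the sphere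
`r⁶ = 4`, both null sets. -/
lemma ae_disc_angFreq_ne_zero (hn : 1 ≤ n) :
    ∀ᵐ η : Space n, η ≠ 0 ∧ disc (angFreq η) ≠ 0 := by
  have : Nonempty (Fin n) := ⟨⟨0, hn⟩⟩
  have hsph : ∀ R : ℝ, ∀ᵐ η : Space n, ‖η‖ ≠ R := by
    intro R
    have := Measure.addHaar_sphere (volume : Measure (Space n)) 0 R
    rw [ae_iff]
    convert! this using 2
    ext η
    simp
  filter_upwards [hsph 0, hsph ((4 : ℝ) ^ (1 / 6 : ℝ) / (2 * Real.pi))] with η h0 h1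
  refine ⟨by simpa using h0, fun hd => h1 ?_⟩
  have hpos : 0 < angFreq η :=
    ((norm_nonneg η).lt_of_ne' h0).trans_le (norm_le_angFreq η)
  have h6 : angFreq η ^ 6 = 4 := by
    unfold disc at hd
    have : angFreq η ^ 2 * (angFreq η ^ 6 - 4) = 0 := by linear_combination 4 * hd
    rcases mul_eq_zero.1 this with h | h
    · exact absurd h (by positivity)
    · linarith
  have h7 : angFreq η = (4 : ℝ) ^ (1 / 6 : ℝ) := by
    rw [← h6, ← Real.rpow_natCast, ← Real.rpow_mul hpos.le]
    norm_num
  rw [← h7, angFreq]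
  field_simp

/-! ### Assembly of the estimate -/

/-- The pointwise bound of the solution in Fourier variables. -/
lemma norm_sq_le_of_modes {l t g₀ g₁ M₀ M₁ : ℝ} (hl : 0 ≤ l) (ht : 0 < t) {η : Space n}
    (hη : η ≠ 0) (hd : disc (angFreq η) ≠ 0) {U V U₀ V₀ : ℂ}
    (hp : V - charRoot (-1) (angFreq η) * U =
      Complex.exp (t * charRoot 1 (angFreq η)) * (V₀ - charRoot (-1) (angFreq η) * U₀))
    (hm : V - charRoot 1 (angFreq η) * U =
      Complex.exp (t * charRoot (-1) (angFreq η)) * (V₀ - charRoot 1 (angFreq η) * U₀))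
    (hg₀ : Real.exp (-(angFreq η ^ 4 / 2) * t) ≤ g₀)
    (hg₁ : angFreq η ≤ 1 →
      Real.exp (-(angFreq η ^ 4 / 2) * t) * min t (2 / angFreq η) ^ 2 ≤ g₁)
    (hg₁0 : 0 ≤ g₁) (hU₀ : ‖U₀‖ ≤ M₀) (hV₀ : ‖V₀‖ ≤ M₁) :
    ‖U‖ ^ 2 ≤ 8 * M₀ ^ 2 * g₀ + 2 * M₁ ^ 2 * g₁ +
      800 * ((2 * (l + 1)) ^ (l + 1) * t ^ (-(l + 1))) *
        ((1 + angFreq η ^ (2 * (l + 1))) * ‖U₀‖ ^ 2 + (1 + angFreq η ^ (2 * l)) * ‖V₀‖ ^ 2) := by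
  have hr : 0 < angFreq η := (norm_pos_iff.2 hη).trans_le (norm_le_angFreq η)
  set r := angFreq η with hr'
  set K := (2 * (l + 1)) ^ (l + 1) * t ^ (-(l + 1)) with hK
  have hK0 : 0 ≤ K := by positivity
  have hg₀0 : 0 ≤ g₀ := (Real.exp_pos _).le.trans hg₀
  have hsq : ∀ a b : ℝ, (a + b) ^ 2 ≤ 2 * (a ^ 2 + b ^ 2) := fun a b => by
    nlinarith [sq_nonneg (a - b)]
  rcases le_total r 1 with h1 | h1
  · have h := norm_le_low hr h1 ht.le hp hm
    set m := min t (2 / r)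
    have hm0 : 0 ≤ m := by positivity
    have e1 : Real.exp (-(r ^ 4 / 4) * t) ^ 2 = Real.exp (-(r ^ 4 / 2) * t) := by
      rw [← Real.exp_nat_mul]; congr 1; push_cast; ring
    have e2 : Real.exp (-(r ^ 4 / 2) * t) ^ 2 ≤ Real.exp (-(r ^ 4 / 2) * t) := by
      apply pow_le_of_le_one (Real.exp_pos _).le _ two_ne_zero
      rw [Real.exp_le_one_iff]
      have : 0 ≤ r ^ 4 / 2 * t := by positivity
      linarith
    calc ‖U‖ ^ 2 ≤ (2 * Real.exp (-(r ^ 4 / 4) * t) * ‖U₀‖ +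
          Real.exp (-(r ^ 4 / 2) * t) * m * ‖V₀‖) ^ 2 := by gcongr
      _ ≤ 2 * ((2 * Real.exp (-(r ^ 4 / 4) * t) * ‖U₀‖) ^ 2 +
          (Real.exp (-(r ^ 4 / 2) * t) * m * ‖V₀‖) ^ 2) := hsq _ _
      _ = 8 * ‖U₀‖ ^ 2 * Real.exp (-(r ^ 4 / 2) * t) +
          2 * ‖V₀‖ ^ 2 * (Real.exp (-(r ^ 4 / 2) * t) ^ 2 * m ^ 2) := by
          rw [← e1]; ring
      _ ≤ 8 * M₀ ^ 2 * g₀ + 2 * M₁ ^ 2 * g₁ := by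
          gcongr
          exact (mul_le_mul_of_nonneg_right e2 (sq_nonneg m)).trans (hg₁ h1)
      _ ≤ _ := le_add_of_nonneg_right (by positivity)
  · have h := norm_le_high h1 hd ht.le hp hm
    have e1 : Real.exp (-t / (4 * r ^ 2)) ^ 2 = Real.exp (-t / (2 * r ^ 2)) := by
      rw [← Real.exp_nat_mul]; congr 1; push_cast; field_simp; norm_num
    have e2 : r ^ (2 * (l + 1)) * r⁻¹ ^ 2 = r ^ (2 * l) := by
      -- The gain `1/r` of the velocity kernel lowers the weight on `V₀` from order `l + 1` to order
      -- `l`.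
      rw [show 2 * (l + 1) = 2 * l + ((2 : ℕ) : ℝ) by push_cast; ring, Real.rpow_add hr,
        Real.rpow_natCast]
      field_simp
    have e3 := exp_neg_div_sq_le hl hr ht
    calc ‖U‖ ^ 2 ≤ (20 * Real.exp (-t / (4 * r ^ 2)) * (‖U₀‖ + r⁻¹ * ‖V₀‖)) ^ 2 := by gcongr
      _ = 400 * Real.exp (-t / (2 * r ^ 2)) * (‖U₀‖ + r⁻¹ * ‖V₀‖) ^ 2 := by rw [← e1]; ring
      _ ≤ 400 * (K * r ^ (2 * (l + 1))) * (2 * (‖U₀‖ ^ 2 + (r⁻¹ * ‖V₀‖) ^ 2)) := by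
          gcongr
          exact hsq _ _
      _ = 800 * K * (r ^ (2 * (l + 1)) * ‖U₀‖ ^ 2 +
          (r ^ (2 * (l + 1)) * r⁻¹ ^ 2) * ‖V₀‖ ^ 2) := by ring
      _ ≤ 800 * K * ((1 + r ^ (2 * (l + 1))) * ‖U₀‖ ^ 2 + (1 + r ^ (2 * l)) * ‖V₀‖ ^ 2) := by
          rw [e2]
          gcongr <;> linarith
      _ ≤ _ := le_add_of_nonneg_left (by positivity)

lemma weightedL1Norm_nonneg (γ : ℝ) (f : L2 n) : 0 ≤ weightedL1Norm γ f :=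
  integral_nonneg fun x => by positivity

lemma hSobolevNorm_nonneg (p : ℝ) (f : L2 n) : 0 ≤ hSobolevNorm p f := Real.sqrt_nonneg _

lemma dataNorm_nonneg (l γ : ℝ) (u₀ u₁ : L2 n) : 0 ≤ dataNorm l γ u₀ u₁ := by
  have h1 := hSobolevNorm_nonneg (l + 1) u₀
  have h2 := hSobolevNorm_nonneg l u₁
  have h3 := weightedL1Norm_nonneg γ u₀
  have h4 := weightedL1Norm_nonneg (γ + 1) u₁
  unfold dataNorm
  positivity

/-- Low frequencies decay with the diffusion rate, high frequencies according to regularity. -/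
theorem exists_norm_sq_le (hn : 1 ≤ n) {l : ℝ} (hl : 0 ≤ l) :
    ∃ C : ℝ, 0 < C ∧ ∀ u₀ u₁ : L2 n, MemHSobolev (l + 1) u₀ → MemWeightedL1 0 u₀ →
      MemHSobolev l u₁ → MemWeightedL1 1 u₁ → ∀ u : ℝ → L2 n, IsSolution u₀ u₁ u →
        ∀ t : ℝ, 2 ≤ t →
          ‖u t‖ ^ 2 ≤ C * dataNorm l 0 u₀ u₁ ^ 2 *
            (diffusionRate n t ^ 2 + t ^ (-(l + 1))) := by
  obtain ⟨C₀, hC₀, h₀⟩ := exists_low_majorant_position hn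
  obtain ⟨C₁, hC₁, h₁⟩ := exists_low_majorant_velocity hn
  set K : ℝ := (2 * (l + 1)) ^ (l + 1) with hK
  have hK0 : 0 < K := by positivity
  -- `1600 = 2 · 800`, as each of the two Sobolev norms is at most the full data norm.
  refine ⟨8 * C₀ + 2 * C₁ + 1600 * K, by positivity, ?_⟩
  rintro u₀ u₁ hs₀ hw₀ hs₁ hw₁ u ⟨v, -, -, hu, -, rfl, rfl, heq⟩ t ht
  have ht0 : 0 < t := by linarith
  obtain ⟨I, hI, hid⟩ := exists_fourier_identity hu heq
  have hU : ∀ t, 0 ≤ t → HasDerivWithinAt (fun s => (𝓕 (u s) : L2 n)) (𝓕 (v t)) (Ici 0) t :=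
    fun t ht => (fourierL n).hasFDerivAt.comp_hasDerivWithinAt t (hu t ht)
  have hp := modes_evolution hU hI hid (s := 1) (by norm_num) ht0.le
  have hm := modes_evolution hU hI hid (s := -1) (by norm_num) ht0.le
  obtain ⟨g₀, ig₀, hg₀, Ig₀⟩ := h₀ t ht
  obtain ⟨g₁, ig₁, ng₁, hg₁, Ig₁⟩ := h₁ t ht
  set D := dataNorm l 0 (u 0) (v 0) with hD
  have n1 := hSobolevNorm_nonneg (l + 1) (u 0)
  have n2 := hSobolevNorm_nonneg l (v 0)
  have n3 := weightedL1Norm_nonneg 0 (u 0)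
  have n4 := weightedL1Norm_nonneg 1 (v 0)
  have hDeq : D = hSobolevNorm (l + 1) (u 0) + hSobolevNorm l (v 0) + weightedL1Norm 0 (u 0) +
      weightedL1Norm 1 (v 0) := by rw [hD, dataNorm, zero_add]
  have b₀ := norm_fourier_le_integral_norm hw₀.1
  have b₁ := norm_fourier_le_integral_norm hw₁.1
  have c₀ := integral_norm_le_weightedL1Norm le_rfl hw₀
  have c₁ := integral_norm_le_weightedL1Norm zero_le_one hw₁
  have iS₀ := integrable_sobolev hs₀
  have iS₁ := integrable_sobolev hs₁
  have hpt : ∀ᵐ η : Space n, ‖(𝓕 (u t) : L2 n) η‖ ^ 2 ≤ 8 * D ^ 2 * g₀ η + 2 * D ^ 2 * g₁ η +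
      800 * (K * t ^ (-(l + 1))) *
        ((1 + angFreq η ^ (2 * (l + 1))) * ‖(𝓕 (u 0) : L2 n) η‖ ^ 2 +
          (1 + angFreq η ^ (2 * l)) * ‖(𝓕 (v 0) : L2 n) η‖ ^ 2) := by
    filter_upwards [hp, hm, b₀, b₁, ae_disc_angFreq_ne_zero hn] with η hp hm hb₀ hb₁ hη
    rw [neg_neg] at hm
    exact norm_sq_le_of_modes hl ht0 hη.1 hη.2 hp hm (hg₀ η) (hg₁ η hη.1) (ng₁ η)
      (by linarith) (by linarith)
  have hint : ‖u t‖ ^ 2 ≤ 8 * D ^ 2 * (∫ η, g₀ η) + 2 * D ^ 2 * (∫ η, g₁ η) +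
      800 * (K * t ^ (-(l + 1))) * (hSobolevNorm (l + 1) (u 0) ^ 2 + hSobolevNorm l (v 0) ^ 2) := by
    have j₀ : Integrable fun η => 8 * D ^ 2 * g₀ η := ig₀.const_mul _
    have j₁ : Integrable fun η => 2 * D ^ 2 * g₁ η := ig₁.const_mul _
    have j₀₁ : Integrable fun η => 8 * D ^ 2 * g₀ η + 2 * D ^ 2 * g₁ η := j₀.add j₁
    have j₂ := (iS₀.fun_add iS₁).const_mul (800 * (K * t ^ (-(l + 1))))
    rw [norm_sq_eq_integral_fourier, ← integral_sobolev, ← integral_sobolev,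
      ← integral_add iS₀ iS₁, ← integral_const_mul, ← integral_const_mul, ← integral_const_mul,
      ← integral_add j₀ j₁, ← integral_add j₀₁ j₂]
    exact integral_mono_of_nonneg (ae_of_all _ fun η => sq_nonneg _) (j₀₁.add j₂) hpt
  have hs₀' : hSobolevNorm (l + 1) (u 0) ^ 2 ≤ D ^ 2 := by gcongr; linarith
  have hs₁' : hSobolevNorm l (v 0) ^ 2 ≤ D ^ 2 := by gcongr; linarith
  have hrate : 0 ≤ diffusionRate n t ^ 2 := sq_nonneg _
  have htl : 0 ≤ t ^ (-(l + 1)) := by positivity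
  calc ‖u t‖ ^ 2 ≤ _ := hint
    _ ≤ 8 * D ^ 2 * (C₀ * diffusionRate n t ^ 2) + 2 * D ^ 2 * (C₁ * diffusionRate n t ^ 2) +
        800 * (K * t ^ (-(l + 1))) * (D ^ 2 + D ^ 2) := by gcongr
    _ = (8 * C₀ + 2 * C₁) * D ^ 2 * diffusionRate n t ^ 2 +
        1600 * K * D ^ 2 * t ^ (-(l + 1)) := by ring
    _ ≤ (8 * C₀ + 2 * C₁) * D ^ 2 * diffusionRate n t ^ 2 +
        1600 * K * D ^ 2 * t ^ (-(l + 1)) +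
        (1600 * K * D ^ 2 * diffusionRate n t ^ 2 + (8 * C₀ + 2 * C₁) * D ^ 2 * t ^ (-(l + 1))) :=
        le_add_of_nonneg_right (by positivity)
    _ = _ := by ring

/-- The factor 3 covers the worse of the two uses: the rate squared once, plus twice from
`rpow_le_diffusionRate_sq`. -/
lemma le_sqrt_mul_of_sq_le {x C D A B : ℝ} (hC : 0 ≤ C) (hD : 0 ≤ D) (hB : 0 ≤ B)
    (h : x ^ 2 ≤ C * D ^ 2 * A) (hA : A ≤ 3 * B ^ 2) :
    x ≤ Real.sqrt (3 * C) * D * B := by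
  apply le_of_sq_le_sq _ (by positivity)
  rw [mul_pow, mul_pow, Real.sq_sqrt (by positivity)]
  calc x ^ 2 ≤ _ := h
    _ ≤ C * D ^ 2 * (3 * B ^ 2) := by gcongr
    _ = _ := by ring

end StructuralDamping

theorem corollary4p1 :
    (∀ (n : ℕ) (l : ℝ), 6 ≤ n → 0 ≤ l → l ≤ (n : ℝ) / 4 - 3 / 2 →
      ∃ C : ℝ, 0 < C ∧ ∃ T : ℝ, ∀ u₀ u₁ : StructuralDamping.L2 n,
        StructuralDamping.MemHSobolev (l + 1) u₀ → StructuralDamping.MemWeightedL1 0 u₀ →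
        StructuralDamping.MemHSobolev l u₁ → StructuralDamping.MemWeightedL1 1 u₁ →
        ∀ u : ℝ → StructuralDamping.L2 n, StructuralDamping.IsSolution u₀ u₁ u →
          ∀ t : ℝ, T ≤ t →
            ‖u t‖ ≤ C * StructuralDamping.dataNorm l 0 u₀ u₁ * t ^ (-(l + 1) / 2)) ∧
    (∀ (n : ℕ) (l : ℝ), 1 ≤ n → 0 ≤ l → (7 ≤ n → (n : ℝ) / 4 - 3 / 2 ≤ l) →
      ∃ C : ℝ, 0 < C ∧ ∃ T : ℝ, ∀ u₀ u₁ : StructuralDamping.L2 n,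
        StructuralDamping.MemHSobolev (l + 1) u₀ → StructuralDamping.MemWeightedL1 0 u₀ →
        StructuralDamping.MemHSobolev l u₁ → StructuralDamping.MemWeightedL1 1 u₁ →
        ∀ u : ℝ → StructuralDamping.L2 n, StructuralDamping.IsSolution u₀ u₁ u →
          ∀ t : ℝ, T ≤ t →
            ‖u t‖ ≤ C * StructuralDamping.dataNorm l 0 u₀ u₁ *
              StructuralDamping.diffusionRate n t) := by
  constructor
  · intro n l hn hl hln
    obtain ⟨C, hC, h⟩ := StructuralDamping.exists_norm_sq_le (n := n) (by omega) hl
    refine ⟨Real.sqrt (3 * C), by positivity, 2, fun u₀ u₁ a b c d u hu t ht => ?_⟩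
    have ht0 : 0 < t := by linarith
    refine StructuralDamping.le_sqrt_mul_of_sq_le hC.le
      (StructuralDamping.dataNorm_nonneg _ _ _ _) (by positivity) (h u₀ u₁ a b c d u hu t ht) ?_
    have e : (t ^ (-(l + 1) / 2)) ^ 2 = t ^ (-(l + 1)) := by
      rw [← Real.rpow_natCast, ← Real.rpow_mul ht0.le]
      congr 1; push_cast; ring
    rw [e, StructuralDamping.diffusionRate_sq_of_three_le (by omega) ht0]
    -- Here `l + 1 ≤ n/4 - 1/2`, so the high frequencies dominate.
    have h1 : t ^ (-(n : ℝ) / 4 + 1 / 2) ≤ t ^ (-(l + 1)) :=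
      Real.rpow_le_rpow_of_exponent_le (by linarith) (by linarith)
    have h2 : 0 ≤ t ^ (-(l + 1)) := by positivity
    linarith
  · intro n l hn hl hln
    obtain ⟨C, hC, h⟩ := StructuralDamping.exists_norm_sq_le (n := n) hn hl
    refine ⟨Real.sqrt (3 * C), by positivity, 2, fun u₀ u₁ a b c d u hu t ht => ?_⟩
    have ht0 : 0 < t := by linarith
    refine StructuralDamping.le_sqrt_mul_of_sq_le hC.le
      (StructuralDamping.dataNorm_nonneg _ _ _ _) (StructuralDamping.diffusionRate_nonneg ht0.le)
      (h u₀ u₁ a b c d u hu t ht) ?_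
    have h1 : t ^ (-(l + 1)) ≤ 2 * StructuralDamping.diffusionRate n t ^ 2 := by
      refine StructuralDamping.rpow_le_diffusionRate_sq hn (by linarith) (fun _ => ?_) ht
      -- For `n ≤ 6` every `l ≥ 0` is enough, because `n/4 - 1/2 ≤ 1 ≤ l + 1`.
      rcases le_or_gt 7 n with h7 | h7
      · linarith [hln h7]
      · have : (n : ℝ) ≤ 6 := by exact_mod_cast Nat.lt_succ_iff.1 h7
        linarith
    linarith
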